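/- **Proposition (Exact transport under the barycentric velocity).** Let $d\in\mathbb N$, let $\mu_0,\mu_1$ be Borel probability measures on $\mathbb R^d$, and let $\gamma$ be a coupling of them, i.e. a Borel probability measure on $\mathbb R^d\times\mathbb R^d$ with marginals $\mu_0$ and $\mu_1$. Let $(U_0,U_1)\sim\gamma$ and assume $\mathbb E\|U_1-U_0\|<\infty$. For $\tau\in[0,1]$ put $U_\tau=(1-\tau)U_0+\tau U_1$ and let $\rho_\tau$ be the law of $U_\tau$. Let $v_\star$ be a jointly Borel measurable version of the barycentric velocity, $$v_\star(u,\tau)=\mathbb E[\,U_1-U_0\mid U_\tau=u\,]\qquad\text{for every }\tau\in[0,1]\text{ and }\rho_\tau\text{-a.e. }u .$$ Assume: 1. (Existence of the flow.) There are maps $X_\tau:\mathbb R^d\to\mathbb R^d$, $\tau\in[0,1]$, each $\mu_0$-measurable, such that for $\mu_0$-a.e. $u$ the curve $\tau\mapsto X_\tau(u)$ is an absolutely continuous solution of $\frac{d}{d\tau}X_\tau(u)=v_\star(X_\tau(u),\tau)$, $X_0(u)=u$; that is, $s\mapsto v_\star(X_s(u),s)$ is integrable on $[0,1]$ and $X_\tau(u)=u+\int_0^\tau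 v_\star(X_s(u),s)\,ds$ for all $\tau\in[0,1]$. 2. (Uniqueness for the continuity equation.) The equation $\partial_\tau\sigma_\tau+\nabla\cdot(\sigma_\tau v_\star(\cdot,\tau))=0$ has at most one weak solution on $[0,1]$ with $\sigma_0=\mu_0$. Here a weak solution is a narrowly continuous curve $(\sigma_\tau)_{\tau\in[0,1]}$ of Borel probability measures on $\mathbb R^d$ with $\sigma_0=\mu_0$ and $\int_0^1\!\int\|v_\star(u,s)\|\,\sigma_s(du)\,ds<\infty$ such that $$\int\varphi\,d\sigma_\tau-\int\varphi\,d\mu_0=\int_0^\tau\!\int\nabla\varphi(u)\cdot v_\star(u,s)\,\sigma_s(du)\,ds$$ for all $\varphi\in C_c^\infty(\mathbb R^d)$ and all $\tau\in[0,1]$. Then $(X_\tau)_\#\mu_0=\rho_\tau$ for every $\tau\in[0,1]$, and in particular $(X_1)_\#\mu_0=\mu_1$. -/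

import Mathlib

open MeasureTheory Set Topology
open scoped ContDiff

namespace RectifiedFlow

/-- `γ` is a coupling of `μ₀` and `μ₁`: its two marginals are `μ₀` and `μ₁`. -/
def IsCoupling {d : ℕ}
    (γ : Measure (EuclideanSpace ℝ (Fin d) × EuclideanSpace ℝ (Fin d)))
    (μ₀ μ₁ : Measure (EuclideanSpace ℝ (Fin d))) : Prop :=
  γ.map Prod.fst = μ₀ ∧ γ.map Prod.snd = μ₁

/-- The linear chord point `T_τ(u₀, u₁) = (1 - τ) u₀ + τ u₁`. -/
def chordPoint {d : ℕ} (τ : ℝ)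
    (p : EuclideanSpace ℝ (Fin d) × EuclideanSpace ℝ (Fin d)) :
    EuclideanSpace ℝ (Fin d) :=
  (1 - τ) • p.1 + τ • p.2

/-- The chord direction `u₁ - u₀`. -/
def chordDirection {d : ℕ}
    (p : EuclideanSpace ℝ (Fin d) × EuclideanSpace ℝ (Fin d)) :
    EuclideanSpace ℝ (Fin d) :=
  p.2 - p.1

/-- `ρ_τ`, the law of `U_τ = (1 - τ) U₀ + τ U₁` when `(U₀, U₁)` has law `γ`. -/
noncomputable def interpolantLaw {d : ℕ}
    (γ : Measure (EuclideanSpace ℝ (Fin d) × EuclideanSpace ℝ (Fin d))) (τ : ℝ) :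
    Measure (EuclideanSpace ℝ (Fin d)) :=
  γ.map (chordPoint τ)

/-- `v` is a Borel version of the barycentric velocity: for each `τ ∈ [0, 1]`,
`v τ u = E[U₁ - U₀ | U_τ = u]` for `ρ_τ`-almost every `u`, that is,
`v τ (U_τ) = E[U₁ - U₀ | σ(U_τ)]` almost surely. -/
structure IsBarycentricVelocity {d : ℕ}
    (γ : Measure (EuclideanSpace ℝ (Fin d) × EuclideanSpace ℝ (Fin d)))
    (v : ℝ → EuclideanSpace ℝ (Fin d) → EuclideanSpace ℝ (Fin d)) : Prop where
  measurable : Measurable (Function.uncurry v)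
  condExp_eq : ∀ τ ∈ Icc (0 : ℝ) 1,
    (fun p => v τ (chordPoint τ p)) =ᵐ[γ]
      γ[chordDirection | MeasurableSpace.comap (chordPoint τ) inferInstance]

/-- `X` is a flow of the field `v` from the initial law `μ₀`: for `μ₀`-almost every `u`, the curve
`τ ↦ X τ u` is an absolutely continuous solution on `[0, 1]` of `∂_τ X τ u = v τ (X τ u)`,
`X 0 u = u`, written in integrated form. -/
structure IsFlow {d : ℕ} (μ₀ : Measure (EuclideanSpace ℝ (Fin d)))
    (v : ℝ → EuclideanSpace ℝ (Fin d) → EuclideanSpace ℝ (Fin d))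
    (X : ℝ → EuclideanSpace ℝ (Fin d) → EuclideanSpace ℝ (Fin d)) : Prop where
  aemeasurable : ∀ τ ∈ Icc (0 : ℝ) 1, AEMeasurable (X τ) μ₀
  integralCurve : ∀ᵐ u ∂μ₀,
    IntervalIntegrable (fun s => v s (X s u)) volume 0 1 ∧
      ∀ τ ∈ Icc (0 : ℝ) 1, X τ u = u + ∫ s in (0 : ℝ)..τ, v s (X s u)

/-- `σ` is a weak solution on `[0, 1]` of the continuity equation `∂_τ σ_τ + ∇ · (σ_τ v_τ) = 0`
with initial law `μ₀`: a narrowly continuous curve of probability measures along which `v` is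
integrable and which satisfies the equation against every test function `φ ∈ C_c^∞`. The pairing
`∇φ(u) · v_s(u)` is written as the derivative of `φ` at `u` in the direction `v_s(u)`. -/
structure IsContinuitySolution {d : ℕ} (μ₀ : Measure (EuclideanSpace ℝ (Fin d)))
    (v : ℝ → EuclideanSpace ℝ (Fin d) → EuclideanSpace ℝ (Fin d))
    (σ : ℝ → ProbabilityMeasure (EuclideanSpace ℝ (Fin d))) : Prop where
  continuousOn : ContinuousOn σ (Icc (0 : ℝ) 1)
  initial : (σ 0 : Measure (EuclideanSpace ℝ (Fin d))) = μ₀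
  integrable : ∫⁻ s in Icc (0 : ℝ) 1, ∫⁻ u, ‖v s u‖ₑ
    ∂(σ s : Measure (EuclideanSpace ℝ (Fin d))) < ⊤
  weak_eq : ∀ φ : EuclideanSpace ℝ (Fin d) → ℝ, ContDiff ℝ ∞ φ → HasCompactSupport φ →
    ∀ τ ∈ Icc (0 : ℝ) 1,
      ∫ u, φ u ∂(σ τ : Measure (EuclideanSpace ℝ (Fin d))) - ∫ u, φ u ∂μ₀ =
        ∫ s in (0 : ℝ)..τ, ∫ u, fderiv ℝ φ u (v s u)
          ∂(σ s : Measure (EuclideanSpace ℝ (Fin d)))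

/-- The continuity equation of `v` has at most one weak solution on `[0, 1]` starting at `μ₀`. -/
def ContinuityUniqueness {d : ℕ} (μ₀ : Measure (EuclideanSpace ℝ (Fin d)))
    (v : ℝ → EuclideanSpace ℝ (Fin d) → EuclideanSpace ℝ (Fin d)) : Prop :=
  ∀ σ σ' : ℝ → ProbabilityMeasure (EuclideanSpace ℝ (Fin d)),
    IsContinuitySolution μ₀ v σ → IsContinuitySolution μ₀ v σ' →
      ∀ τ ∈ Icc (0 : ℝ) 1, σ τ = σ' τ

end RectifiedFlow

/-! The laws of the interpolant and of the flow should both solve the continuity equation of `v`,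
and uniqueness would then identify them. The obstacle is that a weak solution must satisfy `∫∫ ‖v‖
dσ_s ds < ∞`. For the interpolant this holds because conditional expectation contracts `L¹`. For the
flow only the integrability of `v` along almost every single curve is known, with no bound on
average.

The flow is therefore truncated to the set `A` of initial points whose curve has `∫ ‖v‖ ds ≤ M`. By
the chain rule its law from `μ₀` restricted to `A` solves the equation with finite integral
(`flow_weak_eq`), but it lacks the mass of `Aᶜ`. The missing mass is supplied by a solution from
`μ₀` restricted to `Aᶜ` that stays below `ρ_τ` and so inherits its integrability
(`exists_weight_solution`). The sum is an admissible solution from `μ₀`, hence equals `ρ_τ` by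
uniqueness, and so the truncated flow law is at most `ρ_τ` (`restrict_map_le_interpolantLaw`). As
`M` grows the sets `A` exhaust almost every initial point, so the law of the flow is at most `ρ_τ`;
both are probability measures, so they agree.

The dominated solution is a limit of Markov chains: follow a chord between two grid times, and at
each grid time redraw the chord given the current position. The chains are encoded by weights `f` in
`[0, 1]` on the chords. Redrawing is a conditional expectation, which preserves these bounds and the
law of the position. At a grid time the weight depends on the position only, so the chord direction
may be exchanged for `v` there. On a grid chosen so that freezing `v` at its points costs little in
`L¹` (`exists_timeGrid_lintegral_sub_le`), the error vanishes with the mesh, and a weak limit of the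
weights solves the equation. -/

open Filter
open scoped ENNReal NNReal

namespace RectifiedFlow

/-! ### Weak compactness of `[0, 1]`-valued weights -/

section WeakCompactness

variable {Ω ι : Type*} [MeasurableSpace Ω] {γ : Measure Ω}

/-- Approximation criterion for convergence of real functions along a filter. -/
theorem tendsto_of_forall_approx {l : Filter ι} {a : ι → ℝ} {b : ℝ}
    (h : ∀ ε > 0, ∃ (a' : ι → ℝ) (b' : ℝ), (∀ᶠ i in l, |a i - a' i| ≤ ε) ∧ |b - b'| ≤ ε ∧
      Tendsto a' l (𝓝 b')) : Tendsto a l (𝓝 b) := by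
  rw [Metric.tendsto_nhds]
  intro ε hε
  obtain ⟨a', b', h1, h2, h3⟩ := h (ε / 4) (by positivity)
  filter_upwards [h1, Metric.tendsto_nhds.1 h3 (ε / 4) (by positivity)] with i hi1 hi2
  rw [Real.dist_eq] at *
  rw [abs_le] at hi1 h2
  rw [abs_lt] at *
  constructor <;> linarith

theorem integrable_weight_mul {f H : Ω → ℝ} (hf : AEStronglyMeasurable f γ)
    (h01 : ∀ᵐ x ∂γ, f x ∈ Icc (0 : ℝ) 1) (hH : Integrable H γ) :
    Integrable (fun x => f x * H x) γ := by
  refine hH.bdd_mul (c := 1) hf ?_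
  filter_upwards [h01] with x hx
  rw [Real.norm_eq_abs, abs_of_nonneg hx.1]
  exact hx.2

theorem abs_integral_weight_mul_le {f H : Ω → ℝ}
    (h01 : ∀ᵐ x ∂γ, f x ∈ Icc (0 : ℝ) 1) (hH : Integrable H γ) :
    |∫ x, f x * H x ∂γ| ≤ ∫ x, |H x| ∂γ := by
  rw [← Real.norm_eq_abs]
  refine norm_integral_le_of_norm_le hH.abs ?_
  filter_upwards [h01] with x hx
  rw [norm_mul, Real.norm_eq_abs, Real.norm_eq_abs, abs_of_nonneg hx.1]
  exact mul_le_of_le_one_left (abs_nonneg _) hx.2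

/-- Banach–Alaoglu in the dual of `L²`, which is `L²` by Riesz: on a finite measure space the
weights lie in one ball. A single ultrafilter will later give limits at all times simultaneously,
with no extraction of subsequences. -/
theorem exists_weak_limit_of_memLp_two [IsFiniteMeasure γ] (l : Ultrafilter ι) (f : ι → Ω → ℝ)
    (hf : ∀ i, AEStronglyMeasurable (f i) γ) (h01 : ∀ i, ∀ᵐ x ∂γ, f i x ∈ Icc (0 : ℝ) 1) :
    ∃ g : Ω → ℝ, MemLp g 2 γ ∧ ∀ H : Ω → ℝ, MemLp H 2 γ →
      Tendsto (fun i => ∫ x, f i x * H x ∂γ) l (𝓝 (∫ x, g x * H x ∂γ)) := by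
  have hb : ∀ i, ∀ᵐ x ∂γ, ‖f i x‖ ≤ 1 := fun i => by
    filter_upwards [h01 i] with x hx
    rw [Real.norm_eq_abs, abs_of_nonneg hx.1]
    exact hx.2
  have hm : ∀ i, MemLp (f i) 2 γ := fun i => MemLp.of_bound (hf i) 1 (hb i)
  let F : ι → WeakDual ℝ (Lp ℝ 2 γ) := fun i =>
    StrongDual.toWeakDual (InnerProductSpace.toDual ℝ (Lp ℝ 2 γ) ((hm i).toLp (f i)))
  obtain ⟨R, hR⟩ : ∃ R : ℝ, ∀ i, ‖(hm i).toLp (f i)‖ ≤ R := by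
    refine ⟨_, fun i => Lp.norm_le_of_ae_bound (C := 1) zero_le_one ?_⟩
    filter_upwards [(hm i).coeFn_toLp, hb i] with x h1 h2
    rwa [h1]
  have hc := WeakDual.isCompact_closedBall (𝕜 := ℝ) (E := Lp ℝ 2 γ) 0 R
  obtain ⟨ℓ, -, hℓ⟩ := hc.ultrafilter_le_nhds (l.map F) (by
    rw [Ultrafilter.coe_map, le_principal_iff, Filter.mem_map]
    refine Filter.Eventually.of_forall fun i => ?_
    simp only [mem_preimage, Metric.mem_closedBall, dist_zero_right]
    refine le_trans (le_of_eq ?_) (hR i)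
    exact (InnerProductSpace.toDual ℝ (Lp ℝ 2 γ)).norm_map _)
  let g := (InnerProductSpace.toDual ℝ (Lp ℝ 2 γ)).symm (WeakDual.toStrongDual ℓ)
  refine ⟨g, Lp.memLp g, fun H hH => ?_⟩
  have h1 : Tendsto (fun i => F i (hH.toLp H)) l (𝓝 (ℓ (hH.toLp H))) :=
    ((WeakDual.eval_continuous (hH.toLp H)).tendsto ℓ).comp hℓ
  have key : ∀ w : Lp ℝ 2 γ, InnerProductSpace.toDual ℝ (Lp ℝ 2 γ) w (hH.toLp H)
      = ∫ x, w x * H x ∂γ := by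
    intro w
    rw [InnerProductSpace.toDual_apply_apply, L2.inner_def]
    refine integral_congr_ae ?_
    filter_upwards [hH.coeFn_toLp] with x hx
    rw [hx]
    simp [mul_comm]
  have h2 : ℓ (hH.toLp H) = ∫ x, g x * H x ∂γ := by
    rw [← key]
    simp [g]
  rw [h2] at h1
  refine h1.congr fun i => ?_
  refine (key _).trans (integral_congr_ae ?_)
  filter_upwards [(hm i).coeFn_toLp] with x hx
  rw [hx]

/-- Weak sequential compactness, along an ultrafilter, of the functions with values in `[0, 1]`. -/
theorem exists_weak_limit [IsFiniteMeasure γ] (l : Ultrafilter ι) (f : ι → Ω → ℝ)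
    (hf : ∀ i, AEStronglyMeasurable (f i) γ) (h01 : ∀ i, ∀ᵐ x ∂γ, f i x ∈ Icc (0 : ℝ) 1) :
    ∃ g : Ω → ℝ, Measurable g ∧ (∀ x, g x ∈ Icc (0 : ℝ) 1) ∧ ∀ H : Ω → ℝ, Integrable H γ →
      Tendsto (fun i => ∫ x, f i x * H x ∂γ) l (𝓝 (∫ x, g x * H x ∂γ)) := by
  obtain ⟨g, hg, hlim⟩ := exists_weak_limit_of_memLp_two l f hf h01
  have hgi : Integrable g γ := hg.integrable (by norm_num)
  have hset : ∀ s, MeasurableSet s → Tendsto (fun i => ∫ x in s, f i x ∂γ) l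
      (𝓝 (∫ x in s, g x ∂γ)) := by
    intro s hs
    have := hlim (s.indicator 1) ((memLp_indicator_const 2 hs (1 : ℝ) (Or.inr (by simp))))
    simpa [← indicator_mul_right, Pi.one_def, mul_one, integral_indicator hs,
      ← Set.indicator_mul_right] using this
  have hfi : ∀ i, Integrable (f i) γ := fun i => by
    simpa using integrable_weight_mul (hf i) (h01 i) (integrable_const (1 : ℝ))
  -- Testing against indicators transfers both bounds to the limit almost everywhere.
  have hg0 : 0 ≤ᵐ[γ] g := by
    refine ae_nonneg_of_forall_setIntegral_nonneg hgi fun s hs _ => ?_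
    refine ge_of_tendsto (hset s hs) (Filter.Eventually.of_forall fun i => ?_)
    exact integral_nonneg_of_ae (ae_restrict_of_ae ((h01 i).mono fun x hx => hx.1))
  have hg1 : 0 ≤ᵐ[γ] fun x => 1 - g x := by
    refine ae_nonneg_of_forall_setIntegral_nonneg ((integrable_const _).sub hgi) fun s hs _ => ?_
    rw [integral_sub (integrable_const _) hgi.integrableOn, sub_nonneg]
    refine le_of_tendsto (hset s hs) (Filter.Eventually.of_forall fun i => ?_)
    exact integral_mono_ae (hfi i).integrableOn (integrable_const _)
      (ae_restrict_of_ae ((h01 i).mono fun x hx => hx.2))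
  -- A clipped measurable representative satisfies the bounds at every point.
  let g' : Ω → ℝ := fun x => max 0 (min 1 (hg.aestronglyMeasurable.mk g x))
  have hgg : g =ᵐ[γ] g' := by
    filter_upwards [hg.aestronglyMeasurable.ae_eq_mk, hg0, hg1] with x h1 h2 h3
    simp only [g', ← h1]
    simp only [Pi.zero_apply] at h2 h3
    rw [min_eq_right (by linarith), max_eq_right h2]
  have hg'm : Measurable g' := by
    have := hg.aestronglyMeasurable.stronglyMeasurable_mk.measurable
    fun_prop
  have hg'01 : ∀ x, g' x ∈ Icc (0 : ℝ) 1 := fun x =>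
    ⟨le_max_left _ _, max_le zero_le_one (min_le_left _ _)⟩
  refine ⟨g', hg'm, hg'01, fun H hH => ?_⟩
  refine tendsto_of_forall_approx fun ε hε => ?_
  -- Test functions pass from `L²` to `L¹` by approximation with simple functions; the error is
  -- uniform in `i` because all weights are at most `1`.
  obtain ⟨K, hK, -⟩ := (memLp_one_iff_integrable.2 hH).exists_simpleFunc_eLpNorm_sub_lt
    ENNReal.one_ne_top (ε := ENNReal.ofReal ε) (by simpa using hε)
  have hKi : Integrable K γ := SimpleFunc.integrable_of_isFiniteMeasure K
  have hKm : MemLp K 2 γ := K.memLp_of_isFiniteMeasure 2 γ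
  have hHK : ∫ x, |H x - K x| ∂γ ≤ ε := by
    rw [eLpNorm_one_eq_lintegral_enorm] at hK
    have := integral_norm_eq_lintegral_enorm (hH.sub hKi).aestronglyMeasurable
    simp only [Real.norm_eq_abs, Pi.sub_apply] at this hK
    rw [this]
    exact ENNReal.toReal_le_of_le_ofReal hε.le hK.le
  have hdiff : ∀ w : Ω → ℝ, AEStronglyMeasurable w γ → (∀ᵐ x ∂γ, w x ∈ Icc (0 : ℝ) 1) →
      |∫ x, w x * H x ∂γ - ∫ x, w x * K x ∂γ| ≤ ε := by
    intro w hw hw01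
    rw [← integral_sub (integrable_weight_mul hw hw01 hH) (integrable_weight_mul hw hw01 hKi)]
    simp_rw [← mul_sub]
    exact (abs_integral_weight_mul_le hw01 (hH.sub hKi)).trans hHK
  refine ⟨_, _, Filter.Eventually.of_forall fun i => hdiff _ (hf i) (h01 i),
    hdiff g' hg'm.aestronglyMeasurable (ae_of_all _ hg'01), ?_⟩
  have := hlim K hKm
  rwa [integral_congr_ae (hgg.mono fun x hx => by simp only [hx] :
    (fun x => g x * K x) =ᵐ[γ] fun x => g' x * K x)] at this

end WeakCompactness

/-! ### Limits of equi-Lipschitz functions of time -/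

section EquiLipschitz

variable {ι : Type*}

theorem lipschitzOnWith_of_tendsto {l : Filter ι} [l.NeBot] {b : ι → ℝ → ℝ} {c : ℝ → ℝ} {L : ℝ}
    {s : Set ℝ} (hb : ∀ i, ∀ x ∈ s, ∀ y ∈ s, |b i x - b i y| ≤ L * |x - y|)
    (hlim : ∀ x ∈ s, Tendsto (fun i => b i x) l (𝓝 (c x))) :
    ∀ x ∈ s, ∀ y ∈ s, |c x - c y| ≤ L * |x - y| := fun x hx y hy =>
  le_of_tendsto ((hlim x hx).sub (hlim y hy)).abs
    (Filter.Eventually.of_forall fun i => hb i x hx y hy)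

theorem continuousOn_of_abs_sub_le {c : ℝ → ℝ} {L : ℝ} {s : Set ℝ}
    (h : ∀ x ∈ s, ∀ y ∈ s, |c x - c y| ≤ L * |x - y|) : ContinuousOn c s := by
  have : LipschitzOnWith (Real.toNNReal L) c s := by
    refine LipschitzOnWith.of_dist_le_mul fun x hx y hy => ?_
    rw [Real.dist_eq, Real.dist_eq]
    exact (h x hx y hy).trans (mul_le_mul_of_nonneg_right (Real.le_coe_toNNReal L) (abs_nonneg _))
  exact this.continuousOn

/-- Pointwise convergence of equi-Lipschitz functions on `[0, 1]` is uniform. -/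
theorem eventually_forall_abs_sub_le {l : Filter ι} [l.NeBot] {b : ι → ℝ → ℝ} {c : ℝ → ℝ} {L : ℝ}
    (hb : ∀ i, ∀ x ∈ Icc (0 : ℝ) 1, ∀ y ∈ Icc (0 : ℝ) 1, |b i x - b i y| ≤ L * |x - y|)
    (hlim : ∀ x ∈ Icc (0 : ℝ) 1, Tendsto (fun i => b i x) l (𝓝 (c x))) {ε : ℝ} (hε : 0 < ε) :
    ∀ᶠ i in l, ∀ x ∈ Icc (0 : ℝ) 1, |b i x - c x| ≤ ε := by
  have hc := lipschitzOnWith_of_tendsto hb hlim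
  have hL : 0 ≤ L := by
    obtain ⟨i⟩ : Nonempty ι := l.nonempty_of_neBot
    have := hb i 0 (by simp) 1 (by simp)
    simp only [zero_sub, abs_neg, abs_one, mul_one] at this
    exact (abs_nonneg _).trans this
  -- The net is fine enough for the oscillation to be at most `ε / 3`; `L + 1` replaces `L` to allow
  -- `L = 0`.
  set δ := ε / (3 * (L + 1)) with hδ
  have hδ0 : 0 < δ := by positivity
  obtain ⟨u, hu, hufin, hucov⟩ := (isCompact_Icc (a := (0 : ℝ)) (b := 1)).finite_cover_balls hδ0
  have hev : ∀ᶠ i in l, ∀ y ∈ u, |b i y - c y| ≤ ε / 3 := by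
    rw [eventually_all_finite hufin]
    intro y hy
    filter_upwards [Metric.tendsto_nhds.1 (hlim y (hu hy)) (ε / 3) (by positivity)] with i hi
    exact le_of_lt (by rwa [Real.dist_eq] at hi)
  filter_upwards [hev] with i hi x hx
  obtain ⟨y, hy, hxy⟩ := mem_iUnion₂.1 (hucov hx)
  rw [Metric.mem_ball, Real.dist_eq] at hxy
  have h1 := hb i x hx y (hu hy)
  have h2 := hc x hx y (hu hy)
  have h3 := hi y hy
  have h4 : L * |x - y| ≤ ε / 3 := by
    have : L * |x - y| ≤ (L + 1) * δ := by gcongr; linarith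
    refine this.trans (le_of_eq ?_)
    rw [hδ]; field_simp
  rw [abs_le] at *
  constructor <;> linarith

/-- Dominated convergence is not available along an ultrafilter, so uniform convergence takes its
place. -/
theorem tendsto_intervalIntegral_of_equiLipschitz {l : Filter ι} [l.NeBot] {b : ι → ℝ → ℝ}
    {c : ℝ → ℝ} {L : ℝ}
    (hb : ∀ i, ∀ x ∈ Icc (0 : ℝ) 1, ∀ y ∈ Icc (0 : ℝ) 1, |b i x - b i y| ≤ L * |x - y|)
    (hlim : ∀ x ∈ Icc (0 : ℝ) 1, Tendsto (fun i => b i x) l (𝓝 (c x))) {τ : ℝ}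
    (hτ : τ ∈ Icc (0 : ℝ) 1) :
    Tendsto (fun i => ∫ s in (0 : ℝ)..τ, b i s) l (𝓝 (∫ s in (0 : ℝ)..τ, c s)) := by
  have hsub : uIcc 0 τ ⊆ Icc (0 : ℝ) 1 := by
    rw [uIcc_of_le hτ.1]; exact Icc_subset_Icc_right hτ.2
  have hci : IntervalIntegrable c volume 0 τ :=
    ((continuousOn_of_abs_sub_le (lipschitzOnWith_of_tendsto hb hlim)).mono
      hsub).intervalIntegrable
  have hbi : ∀ i, IntervalIntegrable (b i) volume 0 τ := fun i =>
    ((continuousOn_of_abs_sub_le (hb i)).mono hsub).intervalIntegrable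
  rw [Metric.tendsto_nhds]
  intro ε hε
  filter_upwards [eventually_forall_abs_sub_le hb hlim (half_pos hε)] with i hi
  rw [dist_eq_norm, ← intervalIntegral.integral_sub (hbi i) hci]
  have : ‖∫ s in (0 : ℝ)..τ, b i s - c s‖ ≤ ε / 2 * |τ - 0| := by
    refine intervalIntegral.norm_integral_le_of_norm_le_const fun s hs => ?_
    exact hi s (hsub (uIoc_subset_uIcc hs))
  rw [sub_zero, abs_of_nonneg hτ.1] at this
  have h2 := hτ.2
  nlinarith

end EquiLipschitz

/-! ### Chain rule along absolutely continuous curves -/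

section ChainRule

variable {E : Type*} [NormedAddCommGroup E] [NormedSpace ℝ E]

theorem fderiv_bounded_of_hasCompactSupport {φ : E → ℝ} (hφ : ContDiff ℝ ∞ φ)
    (hc : HasCompactSupport φ) : ∃ C : ℝ, 0 ≤ C ∧ (∀ x, ‖fderiv ℝ φ x‖ ≤ C) ∧
      LipschitzWith (Real.toNNReal C) φ := by
  obtain ⟨C, hC⟩ := (hc.fderiv (𝕜 := ℝ)).exists_bound_of_continuous
    (hφ.continuous_fderiv (by simp))
  refine ⟨C, (norm_nonneg _).trans (hC 0), hC, ?_⟩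
  refine lipschitzWith_of_nnnorm_fderiv_le (hφ.differentiable (by simp)) fun x => ?_
  rw [← NNReal.coe_le_coe, coe_nnnorm]
  exact (hC x).trans (Real.le_coe_toNNReal C)

/-- The chain rule in integrated form along an absolutely continuous curve. -/
theorem integral_fderiv_comp_primitive [FiniteDimensional ℝ E] {φ : E → ℝ} (hφ : ContDiff ℝ ∞ φ)
    (hc : HasCompactSupport φ) {g x : ℝ → E} {u : E} {τ : ℝ} (hτ : 0 ≤ τ)
    (hg : IntervalIntegrable g volume 0 τ)
    (hx : ∀ t ∈ Icc (0 : ℝ) τ, x t = u + ∫ s in (0 : ℝ)..t, g s) :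
    ∫ s in (0 : ℝ)..τ, fderiv ℝ φ (x s) (g s) = φ (x τ) - φ u := by
  obtain ⟨C, hC0, -, hLip⟩ := fderiv_bounded_of_hasCompactSupport hφ hc
  set y : ℝ → E := fun t => u + ∫ s in (0 : ℝ)..t, g s with hy
  have hG := (hg.norm).absolutelyContinuousOnInterval_intervalIntegral (c := 0) (by simp)
  -- Increments of `φ ∘ y` are at most `C` times those of the primitive of `‖g‖`. This makes the
  -- real function `φ ∘ y` absolutely continuous, hence the integral of its derivative.
  have hac : AbsolutelyContinuousOnInterval (fun t => φ (y t)) 0 τ := by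
    have hG' := hG.const_mul C
    unfold AbsolutelyContinuousOnInterval at hG' ⊢
    refine squeeze_zero'
      (Filter.Eventually.of_forall fun _ => Finset.sum_nonneg fun _ _ => dist_nonneg) ?_ hG'
    rw [eventually_inf_principal]
    refine Filter.Eventually.of_forall fun I hI => Finset.sum_le_sum fun i hi => ?_
    obtain ⟨h1, h2⟩ := hI.1 i hi
    have hii : ∀ {a b : ℝ}, a ∈ uIcc 0 τ → b ∈ uIcc 0 τ → IntervalIntegrable g volume a b :=
      fun ha hb => hg.mono_set (uIcc_subset_uIcc ha hb)
    have h0 : (0 : ℝ) ∈ uIcc 0 τ := by simp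
    refine (hLip.dist_le_mul _ _).trans ?_
    rw [Real.coe_toNNReal _ hC0, Real.dist_eq, ← mul_sub, abs_mul, abs_of_nonneg hC0]
    refine mul_le_mul_of_nonneg_left ?_ hC0
    rw [dist_eq_norm, hy]
    simp only [add_sub_add_left_eq_sub]
    rw [intervalIntegral.integral_interval_sub_left (hii h0 h1) (hii h0 h2),
      intervalIntegral.integral_interval_sub_left (hii h0 h1).norm (hii h0 h2).norm]
    exact intervalIntegral.norm_integral_le_abs_integral_norm
  have h1 := hac.integral_deriv_eq_sub
  have hy0 : y 0 = u := by simp [hy]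
  rw [hy0, ← show x τ = y τ from hx τ ⟨hτ, le_rfl⟩] at h1
  rw [← h1]
  refine intervalIntegral.integral_congr_ae ?_
  filter_upwards [hg.ae_hasDerivAt_integral] with s hs hsm
  have hs' : s ∈ uIcc 0 τ := uIoc_subset_uIcc hsm
  have hd : HasDerivAt y (g s) s := (hs hs' 0 (by simp)).const_add u
  have hs'' : s ∈ Icc 0 τ := by rwa [uIcc_of_le hτ] at hs'
  have := ((hφ.differentiable (by simp)) (y s)).hasFDerivAt.comp_hasDerivAt s hd
  rw [show x s = y s from hx s hs'']
  exact this.deriv.symm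

end ChainRule


/-! ### Time grids adapted to an integrable field -/

/-- `t 0 = 0 ≤ t 1 ≤ t 2 ≤ ⋯` is a partition of `[0, ∞)`, and `k s` is the index of the interval
`[t j, t (j + 1))` that contains `s`. -/
structure IsTimeGrid (t : ℕ → ℝ) (k : ℝ → ℕ) : Prop where
  zero : t 0 = 0
  mono : Monotone t
  measurable : Measurable k
  le : ∀ s, 0 ≤ s → t (k s) ≤ s
  lt : ∀ s, 0 ≤ s → s < t (k s + 1)

namespace IsTimeGrid

variable {t : ℕ → ℝ} {k : ℝ → ℕ}

theorem nonneg (h : IsTimeGrid t k) (j : ℕ) : 0 ≤ t j := h.zero ▸ h.mono (Nat.zero_le j)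

theorem eq_of_mem (h : IsTimeGrid t k) {s : ℝ} {j : ℕ} (hs : s ∈ Ico (t j) (t (j + 1))) :
    k s = j := by
  have h0 : 0 ≤ s := (h.nonneg j).trans hs.1
  have h1 : k s < j + 1 := h.mono.reflect_lt ((h.le s h0).trans_lt hs.2)
  have h2 : j < k s + 1 := h.mono.reflect_lt (hs.1.trans_lt (h.lt s h0))
  omega

theorem measurable_point (h : IsTimeGrid t k) : Measurable fun s => t (k s) :=
  (measurable_from_nat (f := t)).comp h.measurable

/-- Grid points may coincide, so `k 0` can be positive; only its time is determined. -/
theorem index_zero_of_pos (h : IsTimeGrid t k) : t (k 0) = 0 :=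
  le_antisymm (h.le 0 le_rfl) (h.nonneg _)

end IsTimeGrid

/-- The partition of `[0, ∞)` by one point from each cell `[j / n, (j + 1) / n)`. -/
theorem isTimeGrid_of_cells {n : ℕ} (hn : 0 < n) {c : ℕ → ℝ}
    (hc : ∀ j : ℕ, c j ∈ Ico ((j : ℝ) / n) ((j + 1 : ℝ) / n)) :
    IsTimeGrid (fun j => Nat.casesOn j 0 c)
      (fun s => if s < c ⌊n * s⌋₊ then ⌊n * s⌋₊ else ⌊n * s⌋₊ + 1) := by
  have hn' : (0 : ℝ) < n := by exact_mod_cast hn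
  have hlow : ∀ s : ℝ, 0 ≤ s → (⌊n * s⌋₊ : ℝ) / n ≤ s := fun s hs => by
    rw [div_le_iff₀ hn', mul_comm]; exact Nat.floor_le (by positivity)
  have hup : ∀ s : ℝ, 0 ≤ s → s < ((⌊n * s⌋₊ : ℝ) + 1) / n := fun s hs => by
    rw [lt_div_iff₀ hn', mul_comm]; exact Nat.lt_floor_add_one _
  -- The only chosen point in the cell of `s` is `c ⌊n * s⌋₊`, which is `t (⌊n * s⌋₊ + 1)`;
  -- comparing `s` with it decides between the two possible indices.
  refine ⟨rfl, monotone_nat_of_le_succ ?_, ?_, ?_, ?_⟩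
  · rintro (_ | j)
    · exact le_trans (by positivity) (hc 0).1
    · refine (hc j).2.le.trans ?_
      have := (hc (j + 1)).1
      push_cast at this
      exact this
  · refine Measurable.ite ?_ ?_ ?_
    · exact measurableSet_lt measurable_id ((measurable_from_nat (f := c)).comp
        (Nat.measurable_floor.comp (measurable_const_mul _)))
    · exact Nat.measurable_floor.comp (measurable_const_mul _)
    · exact (measurable_from_nat (f := fun j => j + 1)).comp
        (Nat.measurable_floor.comp (measurable_const_mul _))
  · intro s hs
    split_ifs with h
    · rcases hj : ⌊n * s⌋₊ with _ | j
      · exact hs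
      · refine (hc j).2.le.trans ?_
        have := hlow s hs
        rw [hj] at this
        push_cast at this
        exact this
    · exact not_lt.1 h
  · intro s hs
    split_ifs with h
    · exact h
    · refine (hup s hs).trans_le ?_
      have := (hc (⌊n * s⌋₊ + 1)).1
      push_cast at this
      exact this

/-- Somewhere in each cell `g` is at most its average, and the cell has length `1 / n`. -/
theorem exists_cell_points {n : ℕ} (hn : 0 < n) {g : ℝ → ℝ≥0∞} (hg : Measurable g) :
    ∃ c : ℕ → ℝ, ∀ j : ℕ, c j ∈ Ico ((j : ℝ) / n) ((j + 1 : ℝ) / n) ∧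
      g (c j) ≤ n * ∫⁻ s in Ico ((j : ℝ) / n) ((j + 1 : ℝ) / n), g s := by
  have hn' : (0 : ℝ) < n := by exact_mod_cast hn
  have hvol : ∀ j : ℕ, volume (Ico ((j : ℝ) / n) ((j + 1 : ℝ) / n)) = (n : ℝ≥0∞)⁻¹ := fun j => by
    rw [Real.volume_Ico, ← sub_div, add_sub_cancel_left, one_div, ENNReal.ofReal_inv_of_pos hn',
      ENNReal.ofReal_natCast]
  have hex : ∀ j : ℕ, ∃ x ∈ Ico ((j : ℝ) / n) ((j + 1 : ℝ) / n),
      g x ≤ n * ∫⁻ s in Ico ((j : ℝ) / n) ((j + 1 : ℝ) / n), g s := fun j => by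
    obtain ⟨x, hx, hgx⟩ := exists_le_setLAverage (μ := volume)
      (s := Ico ((j : ℝ) / n) ((j + 1 : ℝ) / n)) (f := g)
      (by rw [hvol]; simp) (by rw [hvol]; simpa using hn.ne') hg.aemeasurable
    refine ⟨x, hx, hgx.trans (le_of_eq ?_)⟩
    rw [setLAverage_eq, hvol, ENNReal.div_eq_inv_mul, inv_inv]
  choose c hc1 hc2 using hex
  exact ⟨c, fun j => ⟨hc1 j, hc2 j⟩⟩

/-- A partition of mesh at most `2 / n` at whose points a given function is controlled by its
integral. -/
theorem exists_timeGrid_lintegral_le {n : ℕ} (hn : 0 < n) {g : ℝ → ℝ≥0∞} (hg : Measurable g) :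
    ∃ t k, IsTimeGrid t k ∧ (∀ j, t (j + 1) - t j ≤ 2 / n) ∧
      ∫⁻ s in Ici (0 : ℝ), g (t (k s)) ≤
        g 0 * ENNReal.ofReal (1 / n) + 2 * ∫⁻ s in Ici (0 : ℝ), g s := by
  have hn' : (0 : ℝ) < n := by exact_mod_cast hn
  obtain ⟨c, hc⟩ := exists_cell_points hn hg
  have hgrid := isTimeGrid_of_cells hn fun j => (hc j).1
  set t : ℕ → ℝ := fun j => Nat.casesOn j 0 c with ht
  set k : ℝ → ℕ := fun s => if s < c ⌊n * s⌋₊ then ⌊n * s⌋₊ else ⌊n * s⌋₊ + 1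
  have hstep0 : t 1 - t 0 ≤ 1 / n := by
    have := (hc 0).1.2
    simp only [Nat.cast_zero, zero_add] at this
    simpa [ht] using this.le
  have hstep : ∀ j, t (j + 2) - t (j + 1) ≤ 2 / n := fun j => by
    have h1 := (hc j).1.1
    have h2 := (hc (j + 1)).1.2
    push_cast at h2
    have : ((j : ℝ) + 1 + 1) / n - j / n = 2 / n := by ring
    change c (j + 1) - c j ≤ _
    linarith
  refine ⟨t, k, hgrid, ?_, ?_⟩
  · rintro (_ | j)
    · refine hstep0.trans ?_
      gcongr
      norm_num
    · exact hstep j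
  have hcover : Ici (0 : ℝ) ⊆ ⋃ j, Ico (t j) (t (j + 1)) := fun s hs =>
    mem_iUnion.2 ⟨k s, hgrid.le s hs, hgrid.lt s hs⟩
  have hcell : ∀ j, ∫⁻ s in Ico (t j) (t (j + 1)), g (t (k s)) =
      g (t j) * ENNReal.ofReal (t (j + 1) - t j) := fun j => by
    rw [setLIntegral_congr_fun measurableSet_Ico
      (fun s hs => by rw [hgrid.eq_of_mem hs] : EqOn _ (fun _ => g (t j)) _),
      setLIntegral_const, Real.volume_Ico]
  calc ∫⁻ s in Ici (0 : ℝ), g (t (k s))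
      ≤ ∫⁻ s in ⋃ j, Ico (t j) (t (j + 1)), g (t (k s)) := lintegral_mono_set hcover
    _ ≤ ∑' j, ∫⁻ s in Ico (t j) (t (j + 1)), g (t (k s)) := lintegral_iUnion_le _ _
    _ = ∑' j, g (t j) * ENNReal.ofReal (t (j + 1) - t j) := by simp_rw [hcell]
    _ = g (t 0) * ENNReal.ofReal (t 1 - t 0) +
        ∑' j, g (t (j + 1)) * ENNReal.ofReal (t (j + 2) - t (j + 1)) :=
      tsum_eq_zero_add' ENNReal.summable
    -- The point `0` is imposed rather than chosen, so its term stays apart. At the others, a step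
    -- of at most `2 / n` meets a cell average with factor `n`, which gives the `2`.
    _ ≤ g 0 * ENNReal.ofReal (1 / n) +
        ∑' j : ℕ, 2 * ∫⁻ s in Ico ((j : ℝ) / n) ((j + 1 : ℝ) / n), g s := by
      refine add_le_add (mul_le_mul' (by rw [hgrid.zero]) (ENNReal.ofReal_le_ofReal hstep0))
        (ENNReal.tsum_le_tsum fun j => ?_)
      · refine (mul_le_mul' (hc j).2 (ENNReal.ofReal_le_ofReal (hstep j))).trans (le_of_eq ?_)
        rw [ENNReal.ofReal_div_of_pos hn', ENNReal.ofReal_natCast, mul_right_comm, mul_comm]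
        rw [ENNReal.mul_div_cancel (by simpa using hn.ne') (by simp)]
        rw [mul_comm]
        simp
    _ = g 0 * ENNReal.ofReal (1 / n) +
        2 * ∫⁻ s in ⋃ j : ℕ, Ico ((j : ℝ) / n) ((j + 1 : ℝ) / n), g s := by
      rw [ENNReal.tsum_mul_left, lintegral_iUnion (fun _ => measurableSet_Ico)]
      have hmono : Monotone fun j : ℕ => (j : ℝ) / n := fun a b hab => by
        dsimp only
        gcongr
      have := hmono.pairwise_disjoint_on_Ico_succ
      simpa using this
    _ ≤ _ := by
      gcongr
      refine iUnion_subset fun j s hs => ?_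
      exact le_trans (by positivity) hs.1

/-- An integrable field can be frozen at the points of a suitable fine partition with a small error
in `L¹`. -/
theorem exists_timeGrid_lintegral_sub_le {Ω F : Type*} [MeasurableSpace Ω] [TopologicalSpace Ω]
    [PolishSpace Ω] [LocallyCompactSpace Ω] [BorelSpace Ω] [NormedAddCommGroup F] [NormedSpace ℝ F]
    [MeasurableSpace F] [BorelSpace F] [SecondCountableTopology F]
    (γ : Measure Ω) [IsProbabilityMeasure γ]
    {V : ℝ → Ω → F} (hV : Measurable (Function.uncurry V)) {M : ℝ≥0∞} (hM : M ≠ ⊤)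
    (hVM : ∀ s ∈ Icc (0 : ℝ) 1, ∫⁻ p, ‖V s p‖ₑ ∂γ ≤ M) {ε : ℝ} (hε : 0 < ε) :
    ∃ t k, IsTimeGrid t k ∧ (∀ j, t (j + 1) - t j ≤ ε) ∧
      ∫⁻ s in Icc (0 : ℝ) 1, ∫⁻ p, ‖V (t (k s)) p - V s p‖ₑ ∂γ ≤ ENNReal.ofReal ε := by
  let _ := TopologicalSpace.upgradeIsCompletelyMetrizable Ω
  let ν : Measure ℝ := volume.restrict (Icc (0 : ℝ) 1)
  have hVint : Integrable (Function.uncurry V) (ν.prod γ) := by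
    refine ⟨hV.aestronglyMeasurable, ?_⟩
    rw [hasFiniteIntegral_iff_enorm, lintegral_prod _ hV.enorm.aemeasurable]
    calc ∫⁻ s in Icc (0 : ℝ) 1, ∫⁻ p, ‖V s p‖ₑ ∂γ ≤ ∫⁻ s in Icc (0 : ℝ) 1, M :=
          setLIntegral_mono measurable_const hVM
      _ < ⊤ := by simp [hM.lt_top]
  -- `V` is compared with a continuous compactly supported `W`, for which freezing in time is
  -- harmless. The grid is then adapted to the error `g` between them, so that `V` is close to `W`
  -- on average at the grid times too.
  obtain ⟨W, hWc, hVW, hWcont, -⟩ := hVint.exists_hasCompactSupport_lintegral_sub_le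
    (ε := ENNReal.ofReal (ε / 8)) (by simpa using hε)
  obtain ⟨C, hC⟩ := hWc.exists_bound_of_continuous hWcont
  have hWu := hWc.uniformContinuous_of_continuous hWcont
  obtain ⟨δ, hδ, hWδ⟩ := Metric.uniformContinuous_iff.1 hWu (ε / 4) (by positivity)
  let g : ℝ → ℝ≥0∞ := (Icc (0 : ℝ) 1).indicator fun s => ∫⁻ p, ‖V s p - W (s, p)‖ₑ ∂γ
  have hVWm : Measurable fun z : ℝ × Ω => ‖V z.1 z.2 - W z‖ₑ :=
    (hV.sub hWcont.measurable).enorm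
  have hgm : Measurable g := (Measurable.lintegral_prod_right hVWm).indicator measurableSet_Icc
  have hgint : ∫⁻ s in Ici (0 : ℝ), g s ≤ ENNReal.ofReal (ε / 8) := by
    refine (setLIntegral_le_lintegral _ _).trans (le_trans (le_of_eq ?_) hVW)
    rw [lintegral_indicator measurableSet_Icc, show ∫⁻ z, ‖Function.uncurry V z - W z‖ₑ ∂ν.prod γ =
      ∫⁻ z : ℝ × Ω, ‖V z.1 z.2 - W z‖ₑ ∂ν.prod γ from rfl, lintegral_prod _ hVWm.aemeasurable]
  -- The bound `M` at the single time `0` is needed because `0` is always a grid point.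
  have hg0 : g 0 ≠ ⊤ := by
    have : g 0 ≤ M + ENNReal.ofReal C := by
      simp only [g]
      rw [indicator_of_mem (by simp)]
      calc ∫⁻ p, ‖V 0 p - W (0, p)‖ₑ ∂γ ≤ ∫⁻ p, (‖V 0 p‖ₑ + ENNReal.ofReal C) ∂γ := by
            refine lintegral_mono fun p => (enorm_sub_le).trans ?_
            gcongr
            rw [← ofReal_norm]
            exact ENNReal.ofReal_le_ofReal (hC _)
        _ = ∫⁻ p, ‖V 0 p‖ₑ ∂γ + ENNReal.ofReal C := by
            rw [lintegral_add_right _ measurable_const]; simp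
        _ ≤ _ := by gcongr; exact hVM 0 (by simp)
    exact ne_top_of_le_ne_top (by simp [hM]) this
  obtain ⟨n, hn0, hn⟩ : ∃ n : ℕ, 0 < n ∧
      (2 / n < δ ∧ 2 / n ≤ ε ∧ (g 0).toReal * (1 / n) ≤ ε / 4) := by
    have h1 : Tendsto (fun n : ℕ => (2 : ℝ) / n) atTop (𝓝 0) :=
      tendsto_const_div_atTop_nhds_zero_nat 2
    have h2 : Tendsto (fun n : ℕ => (g 0).toReal * (1 / (n : ℝ))) atTop (𝓝 0) := by
      simpa using (tendsto_const_div_atTop_nhds_zero_nat (1 : ℝ)).const_mul (g 0).toReal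
    exact ((eventually_gt_atTop 0).and (((h1.eventually (gt_mem_nhds hδ)).and
      ((h1.eventually (ge_mem_nhds hε)).and
        (h2.eventually (ge_mem_nhds (by positivity))))))).exists
  obtain ⟨t, k, hgrid, hmesh, hle⟩ := exists_timeGrid_lintegral_le hn0 hgm
  refine ⟨t, k, hgrid, fun j => (hmesh j).trans hn.2.1, ?_⟩
  -- Triangle inequality through `W`: the error at the grid time, the oscillation of `W`, the error
  -- at `s`.
  have hpt : ∀ s ∈ Icc (0 : ℝ) 1, ∫⁻ p, ‖V (t (k s)) p - V s p‖ₑ ∂γ ≤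
      g (t (k s)) + (ENNReal.ofReal (ε / 4) + g s) := by
    intro s hs
    have hts : t (k s) ∈ Icc (0 : ℝ) 1 := ⟨hgrid.nonneg _, (hgrid.le s hs.1).trans hs.2⟩
    simp only [g]
    rw [indicator_of_mem hts, indicator_of_mem hs]
    have hm1 : Measurable fun p => ‖V (t (k s)) p - W (t (k s), p)‖ₑ :=
      hVWm.comp measurable_prodMk_left
    have hm2 : Measurable fun p => ‖V s p - W (s, p)‖ₑ := hVWm.comp measurable_prodMk_left
    have : ENNReal.ofReal (ε / 4) = ∫⁻ _, ENNReal.ofReal (ε / 4) ∂γ := by simp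
    rw [this, ← lintegral_add_left measurable_const, ← lintegral_add_left hm1]
    refine lintegral_mono fun p => ?_
    have hsplit : V (t (k s)) p - V s p = (V (t (k s)) p - W (t (k s), p)) +
        ((W (t (k s), p) - W (s, p)) - (V s p - W (s, p))) := by abel
    rw [hsplit]
    refine (enorm_add_le _ _).trans (add_le_add le_rfl
      ((enorm_sub_le).trans (add_le_add ?_ le_rfl)))
    rw [← ofReal_norm]
    refine ENNReal.ofReal_le_ofReal ?_
    rw [← dist_eq_norm]
    refine (hWδ ?_).le
    rw [Prod.dist_eq, dist_self, max_eq_left dist_nonneg, Real.dist_eq, abs_sub_comm,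
      abs_of_nonneg (by linarith [hgrid.le s hs.1])]
    have h1 := hgrid.lt s hs.1
    have h2 := hmesh (k s)
    linarith [hn.1]
  have hsub : Icc (0 : ℝ) 1 ⊆ Ici 0 := Icc_subset_Ici_self
  calc ∫⁻ s in Icc (0 : ℝ) 1, ∫⁻ p, ‖V (t (k s)) p - V s p‖ₑ ∂γ
      ≤ ∫⁻ s in Icc (0 : ℝ) 1, (g (t (k s)) + (ENNReal.ofReal (ε / 4) + g s)) :=
        setLIntegral_mono' measurableSet_Icc hpt
    _ = (∫⁻ s in Icc (0 : ℝ) 1, g (t (k s))) +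
        (ENNReal.ofReal (ε / 4) + ∫⁻ s in Icc (0 : ℝ) 1, g s) := by
      rw [lintegral_add_left (f := fun s => g (t (k s))) (hgm.comp hgrid.measurable_point),
        lintegral_add_left measurable_const]
      simp
    _ ≤ (g 0 * ENNReal.ofReal (1 / n) + 2 * ENNReal.ofReal (ε / 8)) +
        (ENNReal.ofReal (ε / 4) + ENNReal.ofReal (ε / 8)) := by
      gcongr
      · exact (lintegral_mono_set hsub).trans (hle.trans (by gcongr))
      · exact (lintegral_mono_set hsub).trans hgint
    _ ≤ (ENNReal.ofReal (ε / 4) + ENNReal.ofReal (2 * (ε / 8))) +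
        (ENNReal.ofReal (ε / 4) + ENNReal.ofReal (ε / 8)) := by
      gcongr
      · rw [← ENNReal.ofReal_toReal hg0, ← ENNReal.ofReal_mul ENNReal.toReal_nonneg]
        exact ENNReal.ofReal_le_ofReal hn.2.2
      · rw [ENNReal.ofReal_mul (by norm_num)]; simp
    _ ≤ ENNReal.ofReal ε := by
      rw [← ENNReal.ofReal_add (by positivity) (by positivity),
        ← ENNReal.ofReal_add (by positivity) (by positivity),
        ← ENNReal.ofReal_add (by positivity) (by positivity)]
      exact ENNReal.ofReal_le_ofReal (by linarith)


/-! ### Test functions along chords -/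

section Chord

variable {d : ℕ}

theorem continuous_chordPoint_uncurry : Continuous fun z : ℝ × EuclideanSpace ℝ (Fin d) ×
    EuclideanSpace ℝ (Fin d) => chordPoint z.1 z.2 := by
  unfold chordPoint; fun_prop

theorem continuous_chordPoint (s : ℝ) : Continuous (chordPoint (d := d) s) := by
  unfold chordPoint; fun_prop

theorem measurable_chordPoint (s : ℝ) : Measurable (chordPoint (d := d) s) :=
  (continuous_chordPoint s).measurable

theorem chordPoint_sub_chordPoint (s r : ℝ) (p : EuclideanSpace ℝ (Fin d) ×
    EuclideanSpace ℝ (Fin d)) : chordPoint s p - chordPoint r p = (s - r) • chordDirection p := by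
  unfold chordPoint chordDirection; module

theorem chordPoint_eq_add (s : ℝ) (p : EuclideanSpace ℝ (Fin d) × EuclideanSpace ℝ (Fin d)) :
    chordPoint s p = p.1 + s • chordDirection p := by
  unfold chordPoint chordDirection; module

theorem hasDerivAt_chordPoint (s : ℝ) (p : EuclideanSpace ℝ (Fin d) × EuclideanSpace ℝ (Fin d)) :
    HasDerivAt (fun s => chordPoint s p) (chordDirection p) s := by
  simp_rw [chordPoint_eq_add]
  simpa using ((hasDerivAt_id s).smul_const (chordDirection p)).const_add p.1

variable {γ : Measure (EuclideanSpace ℝ (Fin d) × EuclideanSpace ℝ (Fin d))}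
  [IsProbabilityMeasure γ]

theorem integrable_comp_chordPoint {ψ : EuclideanSpace ℝ (Fin d) → ℝ} (hψ : Continuous ψ) {C : ℝ}
    (hC : ∀ x, |ψ x| ≤ C) (s : ℝ) : Integrable (fun p => ψ (chordPoint s p)) γ :=
  Integrable.of_bound (hψ.comp (continuous_chordPoint s)).aestronglyMeasurable C
    (ae_of_all _ fun _ => hC _)

theorem abs_apply_le_of_norm_le {E : Type*} [NormedAddCommGroup E] [NormedSpace ℝ E]
    {ℓ : E →L[ℝ] ℝ} {C : ℝ} (h : ‖ℓ‖ ≤ C) (w : E) : |ℓ w| ≤ C * ‖w‖ := by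
  rw [← Real.norm_eq_abs]
  exact (ℓ.le_opNorm w).trans (mul_le_mul_of_nonneg_right h (norm_nonneg _))

theorem integrable_clm_apply {Ω E : Type*} [MeasurableSpace Ω] {μ : Measure Ω}
    [NormedAddCommGroup E] [NormedSpace ℝ E] {ℓ : Ω → E →L[ℝ] ℝ} {w : Ω → E} {C : ℝ}
    (hℓ : AEStronglyMeasurable ℓ μ) (hC : ∀ x, ‖ℓ x‖ ≤ C) (hw : Integrable w μ) :
    Integrable (fun x => ℓ x (w x)) μ := by
  refine (hw.norm.const_mul C).mono' ?_ (ae_of_all _ fun x => abs_apply_le_of_norm_le (hC x) _)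
  exact (ContinuousLinearMap.apply ℝ ℝ).flip.aestronglyMeasurable_comp₂ hℓ hw.aestronglyMeasurable

theorem integrable_fderiv_chordPoint_prod (hint : Integrable chordDirection γ)
    {φ : EuclideanSpace ℝ (Fin d) → ℝ} (hφ : ContDiff ℝ ∞ φ) (hc : HasCompactSupport φ)
    (ν : Measure ℝ) [IsFiniteMeasure ν] :
    Integrable (fun z : ℝ × EuclideanSpace ℝ (Fin d) × EuclideanSpace ℝ (Fin d) =>
      fderiv ℝ φ (chordPoint z.1 z.2) (chordDirection z.2)) (ν.prod γ) := by
  obtain ⟨C, -, hC, -⟩ := fderiv_bounded_of_hasCompactSupport hφ hc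
  have hcont := hφ.continuous_fderiv (by simp)
  have h1 : Integrable (fun z : ℝ × EuclideanSpace ℝ (Fin d) × EuclideanSpace ℝ (Fin d) =>
      chordDirection z.2) (ν.prod γ) := hint.comp_snd ν
  have h2 : Continuous fun z : ℝ × EuclideanSpace ℝ (Fin d) × EuclideanSpace ℝ (Fin d) =>
      fderiv ℝ φ (chordPoint z.1 z.2) := hcont.comp continuous_chordPoint_uncurry
  exact integrable_clm_apply h2.aestronglyMeasurable (fun z => hC _) h1

/-- The derivative of a weighted mean of a test function along the chords, in integrated form. -/
theorem integral_weight_chord_sub {f : EuclideanSpace ℝ (Fin d) × EuclideanSpace ℝ (Fin d) → ℝ}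
    (hf : AEStronglyMeasurable f γ) (h01 : ∀ᵐ x ∂γ, f x ∈ Icc (0 : ℝ) 1)
    (hint : Integrable chordDirection γ)
    {φ : EuclideanSpace ℝ (Fin d) → ℝ} (hφ : ContDiff ℝ ∞ φ) (hc : HasCompactSupport φ) {a b : ℝ}
    (hab : a ≤ b) :
    ∫ p, f p * φ (chordPoint b p) ∂γ - ∫ p, f p * φ (chordPoint a p) ∂γ =
      ∫ s in a..b, ∫ p, f p * fderiv ℝ φ (chordPoint s p) (chordDirection p) ∂γ := by
  obtain ⟨C, hC0, hC, -⟩ := fderiv_bounded_of_hasCompactSupport hφ hc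
  obtain ⟨C', hC'⟩ := hc.exists_bound_of_continuous hφ.continuous
  have hφi := integrable_comp_chordPoint (γ := γ) hφ.continuous hC'
  have hcont := hφ.continuous_fderiv (by simp)
  rw [← integral_sub (integrable_weight_mul hf h01 (hφi b)) (integrable_weight_mul hf h01 (hφi a))]
  have hpt : ∀ p, f p * φ (chordPoint b p) - f p * φ (chordPoint a p) =
      ∫ s in Ioc a b, f p * fderiv ℝ φ (chordPoint s p) (chordDirection p) := by
    intro p
    rw [← mul_sub, integral_const_mul, ← intervalIntegral.integral_of_le hab]
    congr 1
    symm
    refine intervalIntegral.integral_eq_sub_of_hasDerivAt (f := fun s => φ (chordPoint s p))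
      (fun s _ => ?_) ?_
    · exact ((hφ.differentiable (by simp)) _).hasFDerivAt.comp_hasDerivAt s
        (hasDerivAt_chordPoint s p)
    · refine Continuous.intervalIntegrable ?_ _ _
      have := hcont.comp (continuous_chordPoint_uncurry.comp (Continuous.prodMk_left p))
      exact this.clm_apply continuous_const
  simp_rw [hpt]
  rw [intervalIntegral.integral_of_le hab]
  have hi : Integrable (Function.uncurry fun s p => f p * fderiv ℝ φ (chordPoint s p)
      (chordDirection p)) ((volume.restrict (Ioc a b)).prod γ) := by
    have h1 := integrable_fderiv_chordPoint_prod hint hφ hc (volume.restrict (Ioc a b))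
    have h2 : ∀ᵐ z ∂((volume.restrict (Ioc a b)).prod γ), f z.2 ∈ Icc (0 : ℝ) 1 :=
      Measure.quasiMeasurePreserving_snd.ae h01
    exact integrable_weight_mul hf.comp_snd h2 h1
  exact (integral_integral_swap hi).symm

end Chord

/-! ### Bounds and duality for the barycentric velocity -/

section Velocity

variable {d : ℕ} {γ : Measure (EuclideanSpace ℝ (Fin d) × EuclideanSpace ℝ (Fin d))}
  {v : ℝ → EuclideanSpace ℝ (Fin d) → EuclideanSpace ℝ (Fin d)}

theorem IsBarycentricVelocity.measurable_chord (hv : IsBarycentricVelocity γ v) :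
    Measurable fun z : ℝ × EuclideanSpace ℝ (Fin d) × EuclideanSpace ℝ (Fin d) =>
      v z.1 (chordPoint z.1 z.2) :=
  hv.measurable.comp (measurable_fst.prodMk continuous_chordPoint_uncurry.measurable)

theorem IsBarycentricVelocity.integrable (hv : IsBarycentricVelocity γ v) {s : ℝ}
    (hs : s ∈ Icc (0 : ℝ) 1) : Integrable (fun p => v s (chordPoint s p)) γ :=
  integrable_condExp.congr (hv.condExp_eq s hs).symm

/-- Conditional expectation contracts `L¹`; the bound is uniform in time. -/
theorem IsBarycentricVelocity.integral_norm_le (hv : IsBarycentricVelocity γ v) {s : ℝ}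
    (hs : s ∈ Icc (0 : ℝ) 1) :
    ∫ p, ‖v s (chordPoint s p)‖ ∂γ ≤ ∫ p, ‖chordDirection p‖ ∂γ := by
  refine (integral_congr_ae ?_).trans_le (integral_norm_condExp_le
    (m := MeasurableSpace.comap (chordPoint s) inferInstance) _)
  filter_upwards [hv.condExp_eq s hs] with p hp
  rw [hp]

theorem IsBarycentricVelocity.lintegral_enorm_le (hv : IsBarycentricVelocity γ v) {s : ℝ}
    (hs : s ∈ Icc (0 : ℝ) 1) :
    ∫⁻ p, ‖v s (chordPoint s p)‖ₑ ∂γ ≤ ENNReal.ofReal (∫ p, ‖chordDirection p‖ ∂γ) := by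
  rw [← ofReal_integral_norm_eq_lintegral_enorm (hv.integrable hs)]
  exact ENNReal.ofReal_le_ofReal (hv.integral_norm_le hs)

variable [IsProbabilityMeasure γ]

theorem IsBarycentricVelocity.integrable_prod (hv : IsBarycentricVelocity γ v) :
    Integrable (fun z : ℝ × EuclideanSpace ℝ (Fin d) × EuclideanSpace ℝ (Fin d) =>
      v z.1 (chordPoint z.1 z.2)) ((volume.restrict (Icc (0 : ℝ) 1)).prod γ) := by
  refine ⟨hv.measurable_chord.aestronglyMeasurable, ?_⟩
  rw [hasFiniteIntegral_iff_enorm, lintegral_prod _ hv.measurable_chord.enorm.aemeasurable]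
  refine (setLIntegral_mono measurable_const
    (fun s hs => hv.lintegral_enorm_le hs)).trans_lt ?_
  simp

/-- Against functions of `U_s`, the chord direction may be replaced by the velocity. -/
theorem IsBarycentricVelocity.integral_clm_chordDirection (hv : IsBarycentricVelocity γ v)
    (hint : Integrable chordDirection γ) {s : ℝ} (hs : s ∈ Icc (0 : ℝ) 1)
    {ℓ : EuclideanSpace ℝ (Fin d) × EuclideanSpace ℝ (Fin d) → EuclideanSpace ℝ (Fin d) →L[ℝ] ℝ}
    (hℓ : StronglyMeasurable[MeasurableSpace.comap (chordPoint s) inferInstance] ℓ)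
    (hi : Integrable (fun p => ℓ p (chordDirection p)) γ) :
    ∫ p, ℓ p (chordDirection p) ∂γ = ∫ p, ℓ p (v s (chordPoint s p)) ∂γ := by
  have h := condExp_bilin_of_stronglyMeasurable_left
    (ContinuousLinearMap.id ℝ (EuclideanSpace ℝ (Fin d) →L[ℝ] ℝ)) hℓ hi hint
  rw [← integral_condExp (measurable_chordPoint s).comap_le]
  refine integral_congr_ae ?_
  filter_upwards [h, hv.condExp_eq s hs] with p h1 h2
  rw [h2]
  exact h1

end Velocity

/-! ### The resampled Markov chain -/

section Scheme

variable {d : ℕ} (γ : Measure (EuclideanSpace ℝ (Fin d) × EuclideanSpace ℝ (Fin d)))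

/-- The weights of the Markov chain that follows a chord between the times `t j` and `t (j + 1)`
and resamples the chord, given its current position, at the times `t j`: the weight of the chains
which start in `B`, conditioned on the position at time `t j`. -/
noncomputable def schemeWeight (t : ℕ → ℝ) (B : Set (EuclideanSpace ℝ (Fin d))) :
    ℕ → EuclideanSpace ℝ (Fin d) × EuclideanSpace ℝ (Fin d) → ℝ
  | 0 => (chordPoint (t 0) ⁻¹' B).indicator 1
  | j + 1 => γ[schemeWeight t B j | MeasurableSpace.comap (chordPoint (t (j + 1))) inferInstance]

variable {γ} {t : ℕ → ℝ} {k : ℝ → ℕ} {B : Set (EuclideanSpace ℝ (Fin d))}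

/-- That the weight is a function of the position at the last grid time is what later lets the chord
direction be conditioned on that position. -/
theorem stronglyMeasurable_schemeWeight_comap (hB : MeasurableSet B) (j : ℕ) :
    StronglyMeasurable[MeasurableSpace.comap (chordPoint (t j)) inferInstance]
      (schemeWeight γ t B j) := by
  cases j with
  | zero =>
    refine StronglyMeasurable.indicator ?_ ⟨B, hB, rfl⟩
    exact stronglyMeasurable_one
  | succ j => exact stronglyMeasurable_condExp

theorem measurable_schemeWeight (hB : MeasurableSet B) (j : ℕ) :
    Measurable (schemeWeight γ t B j) :=
  ((stronglyMeasurable_schemeWeight_comap hB j).mono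
    (measurable_chordPoint (t j)).comap_le).measurable

theorem measurable_schemeWeight_index (hg : IsTimeGrid t k) (hB : MeasurableSet B) :
    Measurable fun z : ℝ × EuclideanSpace ℝ (Fin d) × EuclideanSpace ℝ (Fin d) =>
      schemeWeight γ t B (k z.1) z.2 := by
  have : Measurable fun z : ℕ × EuclideanSpace ℝ (Fin d) × EuclideanSpace ℝ (Fin d) =>
      schemeWeight γ t B z.1 z.2 :=
    measurable_from_prod_countable_right fun j => measurable_schemeWeight hB j
  exact this.comp ((hg.measurable.comp measurable_fst).prodMk measurable_snd)

variable [IsProbabilityMeasure γ]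

theorem schemeWeight_mem (hB : MeasurableSet B) (j : ℕ) :
    ∀ᵐ p ∂γ, schemeWeight γ t B j p ∈ Icc (0 : ℝ) 1 := by
  induction j with
  | zero =>
    refine ae_of_all _ fun p => ?_
    unfold schemeWeight
    by_cases h : p ∈ chordPoint (t 0) ⁻¹' B <;> simp [h]
  | succ j ih =>
    have hi : Integrable (schemeWeight γ t B j) γ := by
      simpa using integrable_weight_mul (measurable_schemeWeight hB j).aestronglyMeasurable ih
        (integrable_const (1 : ℝ))
    have hm := (measurable_chordPoint (d := d) (t (j + 1))).comap_le
    have h1 := condExp_mono (m := MeasurableSpace.comap (chordPoint (t (j + 1))) inferInstance) hi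
      (integrable_const (1 : ℝ)) (ih.mono fun p hp => hp.2)
    have h0 := condExp_nonneg (μ := γ)
      (m := MeasurableSpace.comap (chordPoint (t (j + 1))) inferInstance)
      (f := schemeWeight γ t B j) (ih.mono fun p hp => hp.1)
    rw [condExp_const hm] at h1
    filter_upwards [h0, h1] with p hp0 hp1
    exact ⟨hp0, hp1⟩

theorem integrable_schemeWeight_mul (hB : MeasurableSet B) (j : ℕ)
    {H : EuclideanSpace ℝ (Fin d) × EuclideanSpace ℝ (Fin d) → ℝ} (hH : Integrable H γ) :
    Integrable (fun p => schemeWeight γ t B j p * H p) γ :=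
  integrable_weight_mul (measurable_schemeWeight hB j).aestronglyMeasurable (schemeWeight_mem hB j)
    hH

/-- Redrawing the chord keeps the law of the current position: `ψ` of the position is measurable for
the conditioning σ-algebra and can be pulled inside. -/
theorem integral_schemeWeight_succ (hB : MeasurableSet B) (j : ℕ)
    {ψ : EuclideanSpace ℝ (Fin d) → ℝ} (hψ : Continuous ψ) {C : ℝ} (hC : ∀ x, |ψ x| ≤ C) :
    ∫ p, schemeWeight γ t B (j + 1) p * ψ (chordPoint (t (j + 1)) p) ∂γ =
      ∫ p, schemeWeight γ t B j p * ψ (chordPoint (t (j + 1)) p) ∂γ := by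
  have hm := (measurable_chordPoint (d := d) (t (j + 1))).comap_le
  have hi : Integrable (schemeWeight γ t B j) γ := by
    simpa using integrable_schemeWeight_mul hB j (t := t) (integrable_const (1 : ℝ))
  have hψm : AEStronglyMeasurable[MeasurableSpace.comap (chordPoint (t (j + 1))) inferInstance]
      (fun p => ψ (chordPoint (t (j + 1)) p)) γ :=
    (hψ.measurable.comp (comap_measurable _)).stronglyMeasurable.aestronglyMeasurable
  have h := condExp_mul_of_aestronglyMeasurable_right (f := schemeWeight γ t B j) hψm
    (integrable_schemeWeight_mul hB j (integrable_comp_chordPoint hψ hC _)) hi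
  have h2 := integral_condExp (μ := γ) hm
    (f := schemeWeight γ t B j * fun p => ψ (chordPoint (t (j + 1)) p))
  rw [integral_congr_ae h] at h2
  exact h2

/-- The point is the right endpoint `s = t (j + 1)`, where `k s` has already jumped, by more than
one if grid points coincide. No jump changes integrals of functions of the position. -/
theorem integral_schemeWeight_index (hg : IsTimeGrid t k) (hB : MeasurableSet B) {j : ℕ} {s : ℝ}
    (hs : s ∈ Icc (t j) (t (j + 1)))
    {ψ : EuclideanSpace ℝ (Fin d) → ℝ} (hψ : Continuous ψ) {C : ℝ} (hC : ∀ x, |ψ x| ≤ C) :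
    ∫ p, schemeWeight γ t B (k s) p * ψ (chordPoint s p) ∂γ =
      ∫ p, schemeWeight γ t B j p * ψ (chordPoint s p) ∂γ := by
  rcases hs.2.lt_or_eq with h | h
  · rw [hg.eq_of_mem ⟨hs.1, h⟩]
  have h0 : 0 ≤ s := (hg.nonneg j).trans hs.1
  have hj : j ≤ k s := by
    have := hg.mono.reflect_lt (hs.1.trans_lt (hg.lt s h0))
    omega
  have key : ∀ i, j ≤ i → i ≤ k s →
      ∫ p, schemeWeight γ t B i p * ψ (chordPoint s p) ∂γ =
        ∫ p, schemeWeight γ t B j p * ψ (chordPoint s p) ∂γ := by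
    intro i hi
    induction i, hi using Nat.le_induction with
    | base => exact fun _ => rfl
    | succ i hi ih =>
      intro hik
      have hts : s = t (i + 1) :=
        le_antisymm (h.trans_le (hg.mono (by omega))) ((hg.mono hik).trans (hg.le s h0))
      rw [← ih (by omega)]
      have := integral_schemeWeight_succ (γ := γ) (t := t) hB i hψ hC
      rwa [← hts] at this
  exact key _ hj le_rfl

/-- The time marginals of the scheme are Lipschitz in time against Lipschitz functions. -/
theorem abs_integral_schemeWeight_sub_le (hg : IsTimeGrid t k) (hB : MeasurableSet B)
    (hint : Integrable chordDirection γ)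
    {ψ : EuclideanSpace ℝ (Fin d) → ℝ} {L : ℝ≥0} (hψ : LipschitzWith L ψ) {C : ℝ}
    (hC : ∀ x, |ψ x| ≤ C) {s r : ℝ} (hr : 0 ≤ r) (hrs : r ≤ s) :
    |∫ p, schemeWeight γ t B (k s) p * ψ (chordPoint s p) ∂γ -
      ∫ p, schemeWeight γ t B (k r) p * ψ (chordPoint r p) ∂γ| ≤
      L * (∫ p, ‖chordDirection p‖ ∂γ) * (s - r) := by
  set c : ℝ → ℝ := fun s => ∫ p, schemeWeight γ t B (k s) p * ψ (chordPoint s p) ∂γ with hc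
  have hψi := integrable_comp_chordPoint (γ := γ) hψ.continuous hC
  -- Between two grid times the weight is fixed and each chord moves by `(s - r)` times its
  -- direction; the estimates then add up over the grid.
  have hstep : ∀ j, ∀ r ∈ Icc (t j) (t (j + 1)), ∀ s ∈ Icc (t j) (t (j + 1)), r ≤ s →
      |c s - c r| ≤ L * (∫ p, ‖chordDirection p‖ ∂γ) * (s - r) := by
    intro j r hr s hs hrs
    simp only [hc]
    rw [integral_schemeWeight_index hg hB hr hψ.continuous hC,
      integral_schemeWeight_index hg hB hs hψ.continuous hC,
      ← integral_sub (integrable_schemeWeight_mul hB j (hψi s))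
        (integrable_schemeWeight_mul hB j (hψi r))]
    simp_rw [← mul_sub]
    refine (abs_integral_weight_mul_le (schemeWeight_mem hB j) ((hψi s).sub (hψi r))).trans ?_
    rw [mul_right_comm, ← integral_const_mul]
    refine integral_mono ((hψi s).sub (hψi r)).abs (hint.norm.const_mul _) fun p => ?_
    have := hψ.dist_le_mul (chordPoint s p) (chordPoint r p)
    rw [dist_eq_norm, dist_eq_norm, chordPoint_sub_chordPoint, norm_smul, Real.norm_eq_abs,
      Real.norm_eq_abs, abs_of_nonneg (sub_nonneg.2 hrs), ← mul_assoc] at this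
    exact this
  have hall : ∀ j, ∀ r ∈ Icc 0 (t j), ∀ s ∈ Icc 0 (t j), r ≤ s →
      |c s - c r| ≤ L * (∫ p, ‖chordDirection p‖ ∂γ) * (s - r) := by
    intro j
    induction j with
    | zero =>
      intro r hr s hs _
      rw [hg.zero] at hr hs
      have h1 : r = 0 := le_antisymm hr.2 hr.1
      have h2 : s = 0 := le_antisymm hs.2 hs.1
      simp [h1, h2]
    | succ j ih =>
      intro r hr s hs hrs
      rcases le_total s (t j) with h | h
      · exact ih r ⟨hr.1, hrs.trans h⟩ s ⟨hs.1, h⟩ hrs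
      rcases le_total r (t j) with h' | h'
      · have h1 := ih r ⟨hr.1, h'⟩ (t j) ⟨hg.nonneg j, le_rfl⟩ h'
        have h2 := hstep j (t j) ⟨le_rfl, hg.mono (Nat.le_succ j)⟩ s ⟨h, hs.2⟩ h
        have h3 := abs_sub_le (c s) (c (t j)) (c r)
        linarith
      · exact hstep j r ⟨h', hr.2⟩ s ⟨h, hs.2⟩ hrs
  have := hg.lt s (hr.trans hrs)
  exact hall (k s + 1) r ⟨hr, hrs.trans this.le⟩ s ⟨hr.trans hrs, this.le⟩ hrs

theorem integrable_schemeWeight_prod (hg : IsTimeGrid t k) (hB : MeasurableSet B)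
    {ν : Measure ℝ} [SFinite ν]
    {H : ℝ × EuclideanSpace ℝ (Fin d) × EuclideanSpace ℝ (Fin d) → ℝ}
    (hH : Integrable H (ν.prod γ)) :
    Integrable (fun z => schemeWeight γ t B (k z.1) z.2 * H z) (ν.prod γ) := by
  refine integrable_weight_mul (measurable_schemeWeight_index hg hB).aestronglyMeasurable ?_ hH
  have hset : MeasurableSet {z : ℝ × EuclideanSpace ℝ (Fin d) × EuclideanSpace ℝ (Fin d) |
      schemeWeight γ t B (k z.1) z.2 ∈ Icc (0 : ℝ) 1} :=
    measurable_schemeWeight_index hg hB measurableSet_Icc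
  refine (Measure.ae_prod_iff_ae_ae hset).2 (ae_of_all _ fun s => ?_)
  exact schemeWeight_mem hB (k s)

/-- The evolution equation of the scheme. -/
theorem integral_schemeWeight_sub_eq (hg : IsTimeGrid t k) (hB : MeasurableSet B)
    (hint : Integrable chordDirection γ)
    {φ : EuclideanSpace ℝ (Fin d) → ℝ} (hφ : ContDiff ℝ ∞ φ) (hc : HasCompactSupport φ) {τ : ℝ}
    (hτ : 0 ≤ τ) :
    ∫ p, schemeWeight γ t B (k τ) p * φ (chordPoint τ p) ∂γ -
      ∫ p, schemeWeight γ t B (k 0) p * φ (chordPoint 0 p) ∂γ =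
      ∫ s in (0 : ℝ)..τ, ∫ p, schemeWeight γ t B (k s) p *
        fderiv ℝ φ (chordPoint s p) (chordDirection p) ∂γ := by
  obtain ⟨C', hC'⟩ := hc.exists_bound_of_continuous hφ.continuous
  set e : ℝ → ℝ := fun s => ∫ p, schemeWeight γ t B (k s) p *
        fderiv ℝ φ (chordPoint s p) (chordDirection p) ∂γ with he
  set c : ℝ → ℝ := fun s => ∫ p, schemeWeight γ t B (k s) p * φ (chordPoint s p) ∂γ with hcdef
  have hei : ∀ a b, a ≤ b → IntervalIntegrable e volume a b := by
    intro a b hab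
    rw [intervalIntegrable_iff_integrableOn_Ioc_of_le hab]
    have h1 := integrable_schemeWeight_prod (B := B) hg hB
      (integrable_fderiv_chordPoint_prod hint hφ hc (volume.restrict (Ioc a b)))
    exact h1.integral_prod_left
  have hstep : ∀ j, ∀ a ∈ Icc (t j) (t (j + 1)), ∀ b ∈ Icc (t j) (t (j + 1)), a ≤ b →
      c b - c a = ∫ s in a..b, e s := by
    intro j a ha b hb hab
    simp only [hcdef]
    rw [integral_schemeWeight_index hg hB ha hφ.continuous hC',
      integral_schemeWeight_index hg hB hb hφ.continuous hC',
      integral_weight_chord_sub (measurable_schemeWeight hB j).aestronglyMeasurable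
        (schemeWeight_mem hB j) hint hφ hc hab]
    -- The integrand involves the chord direction, not the position alone, so the endpoint jump is
    -- not harmless and only the open interval is used.
    refine intervalIntegral.integral_congr_Ioo_of_le hab fun s hs => ?_
    simp only [he]
    rw [hg.eq_of_mem ⟨ha.1.trans hs.1.le, hs.2.trans_le hb.2⟩]
  have hall : ∀ j, ∀ τ ∈ Icc 0 (t j), c τ - c 0 = ∫ s in (0 : ℝ)..τ, e s := by
    intro j
    induction j with
    | zero =>
      intro τ hτ
      rw [hg.zero] at hτ
      rw [le_antisymm hτ.2 hτ.1]
      simp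
    | succ j ih =>
      intro τ hτ
      rcases le_total τ (t j) with h | h
      · exact ih τ ⟨hτ.1, h⟩
      rw [← intervalIntegral.integral_add_adjacent_intervals (hei 0 (t j) (hg.nonneg j))
        (hei (t j) τ h), ← ih (t j) ⟨hg.nonneg j, le_rfl⟩,
        ← hstep j (t j) ⟨le_rfl, hg.mono (Nat.le_succ j)⟩ τ ⟨h, hτ.2⟩ h]
      ring
  exact hall (k τ + 1) τ ⟨hτ, (hg.lt τ hτ).le⟩

end Scheme


/-! ### Replacing chord directions by velocities -/

section Freezing

variable {d : ℕ} {γ : Measure (EuclideanSpace ℝ (Fin d) × EuclideanSpace ℝ (Fin d))}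
  {t : ℕ → ℝ} {k : ℝ → ℕ} {B : Set (EuclideanSpace ℝ (Fin d))}
  {v : ℝ → EuclideanSpace ℝ (Fin d) → EuclideanSpace ℝ (Fin d)}

theorem measurable_velocity_point (hg : IsTimeGrid t k) (hv : IsBarycentricVelocity γ v) :
    Measurable fun z : ℝ × EuclideanSpace ℝ (Fin d) × EuclideanSpace ℝ (Fin d) =>
      v (t (k z.1)) (chordPoint (t (k z.1)) z.2) :=
  hv.measurable_chord.comp ((hg.measurable_point.comp measurable_fst).prodMk measurable_snd)

variable [IsProbabilityMeasure γ]

/-- With the gradient frozen at the grid time, the whole coefficient of the direction depends on the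
position there, so the exchange of direction and velocity is exact. -/
theorem integral_schemeWeight_clm_eq (hg : IsTimeGrid t k) (hB : MeasurableSet B)
    (hint : Integrable chordDirection γ) (hv : IsBarycentricVelocity γ v)
    {φ : EuclideanSpace ℝ (Fin d) → ℝ} (hφ : ContDiff ℝ ∞ φ) (hc : HasCompactSupport φ) {s : ℝ}
    (hs : s ∈ Icc (0 : ℝ) 1) :
    ∫ p, schemeWeight γ t B (k s) p *
        fderiv ℝ φ (chordPoint (t (k s)) p) (chordDirection p) ∂γ =
      ∫ p, schemeWeight γ t B (k s) p *
        fderiv ℝ φ (chordPoint (t (k s)) p) (v (t (k s)) (chordPoint (t (k s)) p)) ∂γ := by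
  obtain ⟨C, -, hC, -⟩ := fderiv_bounded_of_hasCompactSupport hφ hc
  have hcont := hφ.continuous_fderiv (by simp)
  have hts : t (k s) ∈ Icc (0 : ℝ) 1 := ⟨hg.nonneg _, (hg.le s hs.1).trans hs.2⟩
  have hm : StronglyMeasurable[MeasurableSpace.comap (chordPoint (t (k s))) inferInstance]
      fun p => schemeWeight γ t B (k s) p • fderiv ℝ φ (chordPoint (t (k s)) p) := by
    refine (stronglyMeasurable_schemeWeight_comap hB _).smul ?_
    exact (hcont.measurable.comp (comap_measurable _)).stronglyMeasurable
  have hi := integrable_schemeWeight_mul (γ := γ) (t := t) hB (k s)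
    (integrable_clm_apply (C := C) (μ := γ)
    (hcont.comp (continuous_chordPoint (t (k s)))).aestronglyMeasurable (fun _ => hC _) hint)
  exact hv.integral_clm_chordDirection hint hts hm hi

/-- The error made by replacing the chord direction by the velocity in the evolution equation of the
scheme. -/
theorem abs_integral_schemeWeight_fderiv_sub_le (hg : IsTimeGrid t k) (hB : MeasurableSet B)
    (hint : Integrable chordDirection γ) (hv : IsBarycentricVelocity γ v)
    {φ : EuclideanSpace ℝ (Fin d) → ℝ} (hφ : ContDiff ℝ ∞ φ) (hc : HasCompactSupport φ) {C : ℝ}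
    (hC : ∀ x, ‖fderiv ℝ φ x‖ ≤ C) {s : ℝ} (hs : s ∈ Icc (0 : ℝ) 1) :
    |∫ p, schemeWeight γ t B (k s) p * fderiv ℝ φ (chordPoint s p) (chordDirection p) ∂γ -
      ∫ p, schemeWeight γ t B (k s) p * fderiv ℝ φ (chordPoint s p) (v s (chordPoint s p)) ∂γ| ≤
      ∫ p, (‖fderiv ℝ φ (chordPoint s p) - fderiv ℝ φ (chordPoint (t (k s)) p)‖ *
        (‖chordDirection p‖ + ‖v s (chordPoint s p)‖) +
        C * ‖v (t (k s)) (chordPoint (t (k s)) p) - v s (chordPoint s p)‖) ∂γ := by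
  have hcont := hφ.continuous_fderiv (by simp)
  have hts : t (k s) ∈ Icc (0 : ℝ) 1 := ⟨hg.nonneg _, (hg.le s hs.1).trans hs.2⟩
  have hLm : ∀ r, AEStronglyMeasurable (fun p => fderiv ℝ φ (chordPoint r p)) γ := fun r =>
    (hcont.comp (continuous_chordPoint r)).aestronglyMeasurable
  have hLi : ∀ r, ∀ w : _ → EuclideanSpace ℝ (Fin d), Integrable w γ →
      Integrable (fun p => fderiv ℝ φ (chordPoint r p) (w p)) γ := fun r w hw =>
    integrable_clm_apply (C := C) (hLm r) (fun _ => hC _) hw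
  have hFi : ∀ r, ∀ w : _ → EuclideanSpace ℝ (Fin d), Integrable w γ →
      Integrable (fun p => schemeWeight γ t B (k s) p * fderiv ℝ φ (chordPoint r p) (w p)) γ :=
    fun r w hw => integrable_schemeWeight_mul hB _ (hLi r w hw)
  have hVs := hv.integrable hs
  have hVt := hv.integrable hts
  -- This exact identity at the grid time is subtracted, so that only differences between the times
  -- `s` and `t (k s)` remain.
  have hz : ∫ p, (schemeWeight γ t B (k s) p *
        fderiv ℝ φ (chordPoint (t (k s)) p) (chordDirection p) - schemeWeight γ t B (k s) p *
        fderiv ℝ φ (chordPoint (t (k s)) p) (v (t (k s)) (chordPoint (t (k s)) p))) ∂γ = 0 := by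
    rw [integral_sub (hFi _ _ hint) (hFi _ _ hVt),
      integral_schemeWeight_clm_eq hg hB hint hv hφ hc hs, sub_self]
  have hA := (hFi s _ hint).sub (hFi s _ hVs)
  have hZ := (hFi (t (k s)) _ hint).sub (hFi (t (k s)) _ hVt)
  simp only [Pi.sub_def] at hA hZ
  rw [← integral_sub (hFi _ _ hint) (hFi _ _ hVs), ← sub_zero (∫ p, _ ∂γ), ← hz,
    ← integral_sub hA hZ, ← Real.norm_eq_abs]
  refine norm_integral_le_of_norm_le ?_ ?_
  · refine Integrable.add ?_ ((hVt.sub hVs).norm.const_mul C)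
    refine (hint.norm.add hVs.norm).bdd_mul (c := C + C) ((hLm _).sub (hLm _)).norm
      (ae_of_all _ fun p => ?_)
    rw [norm_norm]
    exact (norm_sub_le _ _).trans (add_le_add (hC _) (hC _))
  · filter_upwards [schemeWeight_mem (γ := γ) (t := t) hB (k s)] with p hp
    set L := fderiv ℝ φ (chordPoint s p)
    set L' := fderiv ℝ φ (chordPoint (t (k s)) p) with hL'
    set D := chordDirection p
    set V := v s (chordPoint s p)
    set V' := v (t (k s)) (chordPoint (t (k s)) p)
    have hsplit : schemeWeight γ t B (k s) p * L D - schemeWeight γ t B (k s) p * L V -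
        (schemeWeight γ t B (k s) p * L' D - schemeWeight γ t B (k s) p * L' V') =
        schemeWeight γ t B (k s) p * ((L - L') D - (L - L') V + L' (V' - V)) := by
      simp only [sub_apply, map_sub]
      ring
    rw [hsplit, norm_mul, Real.norm_eq_abs, abs_of_nonneg hp.1]
    refine (mul_le_of_le_one_left (norm_nonneg _) hp.2).trans ?_
    refine (norm_add_le _ _).trans (add_le_add ?_ ?_)
    · rw [mul_add]
      exact (norm_sub_le _ _).trans (add_le_add (ContinuousLinearMap.le_opNorm _ _)
        (ContinuousLinearMap.le_opNorm _ _))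
    · exact (ContinuousLinearMap.le_opNorm _ _).trans
        (mul_le_mul_of_nonneg_right (hC _) (norm_nonneg _))

theorem measurable_fderiv_point (hg : IsTimeGrid t k)
    {φ : EuclideanSpace ℝ (Fin d) → ℝ} (hφ : ContDiff ℝ ∞ φ) :
    Measurable fun z : ℝ × EuclideanSpace ℝ (Fin d) × EuclideanSpace ℝ (Fin d) =>
      fderiv ℝ φ (chordPoint (t (k z.1)) z.2) :=
  ((hφ.continuous_fderiv (by simp)).comp continuous_chordPoint_uncurry).measurable.comp
    ((hg.measurable_point.comp measurable_fst).prodMk measurable_snd)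

theorem integrable_velocity_point_sub (hg : IsTimeGrid t k) (hv : IsBarycentricVelocity γ v)
    {ε : ℝ} (hε : ∫⁻ s in Icc (0 : ℝ) 1, ∫⁻ p, ‖v (t (k s)) (chordPoint (t (k s)) p) -
      v s (chordPoint s p)‖ₑ ∂γ ≤ ENNReal.ofReal ε) (hε0 : 0 ≤ ε) :
    Integrable (fun z : ℝ × EuclideanSpace ℝ (Fin d) × EuclideanSpace ℝ (Fin d) =>
      ‖v (t (k z.1)) (chordPoint (t (k z.1)) z.2) - v z.1 (chordPoint z.1 z.2)‖)
      ((volume.restrict (Icc (0 : ℝ) 1)).prod γ) ∧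
    ∫ z, ‖v (t (k z.1)) (chordPoint (t (k z.1)) z.2) - v z.1 (chordPoint z.1 z.2)‖
      ∂((volume.restrict (Icc (0 : ℝ) 1)).prod γ) ≤ ε := by
  have hm : Measurable fun z : ℝ × EuclideanSpace ℝ (Fin d) × EuclideanSpace ℝ (Fin d) =>
      v (t (k z.1)) (chordPoint (t (k z.1)) z.2) - v z.1 (chordPoint z.1 z.2) :=
    (measurable_velocity_point hg hv).sub hv.measurable_chord
  have hle : ∫⁻ z, ‖v (t (k z.1)) (chordPoint (t (k z.1)) z.2) - v z.1 (chordPoint z.1 z.2)‖ₑ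
      ∂((volume.restrict (Icc (0 : ℝ) 1)).prod γ) ≤ ENNReal.ofReal ε := by
    rw [lintegral_prod _ hm.enorm.aemeasurable]
    exact hε
  constructor
  · refine Integrable.norm ⟨hm.aestronglyMeasurable, ?_⟩
    exact hle.trans_lt ENNReal.ofReal_lt_top
  · rw [integral_norm_eq_lintegral_enorm hm.aestronglyMeasurable]
    exact ENNReal.toReal_le_of_le_ofReal hε0 hle

theorem integrable_fderiv_point_sub_mul (hg : IsTimeGrid t k)
    (hint : Integrable chordDirection γ) (hv : IsBarycentricVelocity γ v)
    {φ : EuclideanSpace ℝ (Fin d) → ℝ} (hφ : ContDiff ℝ ∞ φ) {C : ℝ}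
    (hC : ∀ x, ‖fderiv ℝ φ x‖ ≤ C) :
    Integrable (fun z : ℝ × EuclideanSpace ℝ (Fin d) × EuclideanSpace ℝ (Fin d) =>
      ‖fderiv ℝ φ (chordPoint z.1 z.2) - fderiv ℝ φ (chordPoint (t (k z.1)) z.2)‖ *
        (‖chordDirection z.2‖ + ‖v z.1 (chordPoint z.1 z.2)‖))
      ((volume.restrict (Icc (0 : ℝ) 1)).prod γ) := by
  have hD : Integrable (fun z : ℝ × EuclideanSpace ℝ (Fin d) × EuclideanSpace ℝ (Fin d) =>
      ‖chordDirection z.2‖ + ‖v z.1 (chordPoint z.1 z.2)‖)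
      ((volume.restrict (Icc (0 : ℝ) 1)).prod γ) :=
    (hint.comp_snd _).norm.add hv.integrable_prod.norm
  have hm : Measurable fun z : ℝ × EuclideanSpace ℝ (Fin d) × EuclideanSpace ℝ (Fin d) =>
      ‖fderiv ℝ φ (chordPoint z.1 z.2) - fderiv ℝ φ (chordPoint (t (k z.1)) z.2)‖ :=
    (((hφ.continuous_fderiv (by simp)).comp continuous_chordPoint_uncurry).measurable.sub
      (measurable_fderiv_point hg hφ)).norm
  refine hD.bdd_mul (c := C + C) hm.aestronglyMeasurable (ae_of_all _ fun z => ?_)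
  rw [norm_norm]
  exact (norm_sub_le _ _).trans (add_le_add (hC _) (hC _))

theorem integrable_schemeWeight_fderiv_velocity (hg : IsTimeGrid t k) (hB : MeasurableSet B)
    (hv : IsBarycentricVelocity γ v)
    {φ : EuclideanSpace ℝ (Fin d) → ℝ} (hφ : ContDiff ℝ ∞ φ) (hc : HasCompactSupport φ) :
    Integrable (fun s => ∫ p, schemeWeight γ t B (k s) p *
      fderiv ℝ φ (chordPoint s p) (v s (chordPoint s p)) ∂γ) (volume.restrict (Icc (0 : ℝ) 1)) := by
  obtain ⟨C, -, hC, -⟩ := fderiv_bounded_of_hasCompactSupport hφ hc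
  have h2 : Continuous fun z : ℝ × EuclideanSpace ℝ (Fin d) × EuclideanSpace ℝ (Fin d) =>
      fderiv ℝ φ (chordPoint z.1 z.2) :=
    (hφ.continuous_fderiv (by simp)).comp continuous_chordPoint_uncurry
  have h1 := integrable_schemeWeight_prod (B := B) hg hB
    (integrable_clm_apply h2.aestronglyMeasurable (fun z => hC _) hv.integrable_prod)
  exact h1.integral_prod_left

/-- The bound does not see the weights: it consists of the oscillation of the gradient over a grid
step, which vanishes with the mesh, and the freezing error, controlled by the choice of grid. -/
theorem abs_intervalIntegral_schemeWeight_sub_le (hg : IsTimeGrid t k) (hB : MeasurableSet B)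
    (hint : Integrable chordDirection γ) (hv : IsBarycentricVelocity γ v)
    {φ : EuclideanSpace ℝ (Fin d) → ℝ} (hφ : ContDiff ℝ ∞ φ) (hc : HasCompactSupport φ) {C : ℝ}
    (hC : ∀ x, ‖fderiv ℝ φ x‖ ≤ C) {ε : ℝ} (hε0 : 0 ≤ ε)
    (hε : ∫⁻ s in Icc (0 : ℝ) 1, ∫⁻ p, ‖v (t (k s)) (chordPoint (t (k s)) p) -
      v s (chordPoint s p)‖ₑ ∂γ ≤ ENNReal.ofReal ε) {τ : ℝ} (hτ : τ ∈ Icc (0 : ℝ) 1) :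
    |(∫ s in (0 : ℝ)..τ, ∫ p, schemeWeight γ t B (k s) p *
        fderiv ℝ φ (chordPoint s p) (chordDirection p) ∂γ) -
      ∫ s in (0 : ℝ)..τ, ∫ p, schemeWeight γ t B (k s) p *
        fderiv ℝ φ (chordPoint s p) (v s (chordPoint s p)) ∂γ| ≤
      (∫ z, ‖fderiv ℝ φ (chordPoint z.1 z.2) - fderiv ℝ φ (chordPoint (t (k z.1)) z.2)‖ *
        (‖chordDirection z.2‖ + ‖v z.1 (chordPoint z.1 z.2)‖)
        ∂((volume.restrict (Icc (0 : ℝ) 1)).prod γ)) + C * ε := by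
  have hC0 : 0 ≤ C := (norm_nonneg _).trans (hC 0)
  have hsub : Ioc 0 τ ⊆ Icc (0 : ℝ) 1 :=
    Ioc_subset_Icc_self.trans (Icc_subset_Icc_right hτ.2)
  have hi1 : IntegrableOn (fun s => ∫ p, schemeWeight γ t B (k s) p *
      fderiv ℝ φ (chordPoint s p) (chordDirection p) ∂γ) (Icc (0 : ℝ) 1) :=
    (integrable_schemeWeight_prod (B := B) hg hB (integrable_fderiv_chordPoint_prod hint hφ hc
      (volume.restrict (Icc (0 : ℝ) 1)))).integral_prod_left
  have hi2 := integrable_schemeWeight_fderiv_velocity (B := B) hg hB hv hφ hc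
  obtain ⟨hV1, hV2⟩ := integrable_velocity_point_sub hg hv hε hε0
  have hR1 := integrable_fderiv_point_sub_mul hg hint hv hφ hC
  have hR := hR1.add (hV1.const_mul C)
  rw [intervalIntegral.integral_of_le hτ.1, intervalIntegral.integral_of_le hτ.1,
    ← integral_sub (hi1.mono_set hsub) (IntegrableOn.mono_set hi2 hsub)]
  calc _ ≤ ∫ s in Ioc 0 τ, |(∫ p, schemeWeight γ t B (k s) p *
        fderiv ℝ φ (chordPoint s p) (chordDirection p) ∂γ) -
        ∫ p, schemeWeight γ t B (k s) p *
        fderiv ℝ φ (chordPoint s p) (v s (chordPoint s p)) ∂γ| := abs_integral_le_integral_abs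
    _ ≤ ∫ s in Icc (0 : ℝ) 1, |(∫ p, schemeWeight γ t B (k s) p *
        fderiv ℝ φ (chordPoint s p) (chordDirection p) ∂γ) -
        ∫ p, schemeWeight γ t B (k s) p *
        fderiv ℝ φ (chordPoint s p) (v s (chordPoint s p)) ∂γ| :=
      setIntegral_mono_set (hi1.sub hi2).abs (ae_of_all _ fun _ => abs_nonneg _)
        hsub.eventuallyLE
    _ ≤ ∫ s in Icc (0 : ℝ) 1, ∫ p,
        (‖fderiv ℝ φ (chordPoint s p) - fderiv ℝ φ (chordPoint (t (k s)) p)‖ *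
        (‖chordDirection p‖ + ‖v s (chordPoint s p)‖) +
        C * ‖v (t (k s)) (chordPoint (t (k s)) p) - v s (chordPoint s p)‖) ∂γ := by
      refine setIntegral_mono_on (hi1.sub hi2).abs hR.integral_prod_left measurableSet_Icc
        fun s hs => ?_
      exact abs_integral_schemeWeight_fderiv_sub_le hg hB hint hv hφ hc hC hs
    _ = ∫ z, (‖fderiv ℝ φ (chordPoint z.1 z.2) - fderiv ℝ φ (chordPoint (t (k z.1)) z.2)‖ *
        (‖chordDirection z.2‖ + ‖v z.1 (chordPoint z.1 z.2)‖) +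
        C * ‖v (t (k z.1)) (chordPoint (t (k z.1)) z.2) - v z.1 (chordPoint z.1 z.2)‖)
        ∂((volume.restrict (Icc (0 : ℝ) 1)).prod γ) := (integral_prod _ hR).symm
    _ ≤ _ := by
      rw [integral_add hR1 (hV1.const_mul C), integral_const_mul]
      gcongr

end Freezing


/-! ### Lipschitz weights and passage to the limit -/

section Limit

variable {d : ℕ} {γ : Measure (EuclideanSpace ℝ (Fin d) × EuclideanSpace ℝ (Fin d))}

theorem measurable_prodMk_chordPoint :
    Measurable fun z : ℝ × EuclideanSpace ℝ (Fin d) × EuclideanSpace ℝ (Fin d) =>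
      (z.1, chordPoint z.1 z.2) :=
  (continuous_fst.prodMk continuous_chordPoint_uncurry).measurable

variable [IsProbabilityMeasure γ]

/-- A function of time and position, integrable along the chords, is approximated in `L¹` by bounded
Lipschitz functions. -/
theorem exists_lipschitz_chord_approx {H : ℝ × EuclideanSpace ℝ (Fin d) → ℝ} (hH : Measurable H)
    (hHi : Integrable (fun z : ℝ × EuclideanSpace ℝ (Fin d) × EuclideanSpace ℝ (Fin d) =>
      H (z.1, chordPoint z.1 z.2)) ((volume.restrict (Icc (0 : ℝ) 1)).prod γ)) {ε : ℝ}
    (hε : 0 < ε) :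
    ∃ (w : ℝ × EuclideanSpace ℝ (Fin d) → ℝ) (L : ℝ≥0) (C : ℝ), LipschitzWith L w ∧
      (∀ x, |w x| ≤ C) ∧
      ∫ z, |H (z.1, chordPoint z.1 z.2) - w (z.1, chordPoint z.1 z.2)|
        ∂((volume.restrict (Icc (0 : ℝ) 1)).prod γ) ≤ ε := by
  set P := (volume.restrict (Icc (0 : ℝ) 1)).prod γ
  set U : ℝ × EuclideanSpace ℝ (Fin d) × EuclideanSpace ℝ (Fin d) → ℝ × EuclideanSpace ℝ (Fin d) :=
    fun z => (z.1, chordPoint z.1 z.2)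
  have hU : Measurable U := measurable_prodMk_chordPoint
  have hHi' : Integrable H (P.map U) :=
    (integrable_map_measure hH.aestronglyMeasurable hU.aemeasurable).2 hHi
  -- Smooth compactly supported functions are dense in `L¹` of the law of time and position.
  obtain ⟨w, hwc, hw, hwε⟩ := (memLp_one_iff_integrable.2 hHi').exist_eLpNorm_sub_le
    ENNReal.one_ne_top le_rfl hε
  obtain ⟨L, -, -, hL⟩ := fderiv_bounded_of_hasCompactSupport hw hwc
  obtain ⟨C, hC⟩ := hwc.exists_bound_of_continuous hw.continuous
  refine ⟨w, _, C, hL, hC, ?_⟩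
  rw [eLpNorm_one_eq_lintegral_enorm,
    lintegral_map (hH.sub hw.continuous.measurable).enorm hU] at hwε
  have hm : AEStronglyMeasurable (fun z => H (U z) - w (U z)) P :=
    ((hH.sub hw.continuous.measurable).comp hU).aestronglyMeasurable
  have := integral_norm_eq_lintegral_enorm hm
  simp only [Real.norm_eq_abs] at this
  rw [this]
  exact ENNReal.toReal_le_of_le_ofReal hε.le hwε

/-- The properties of a family of weights on the chords which are stable under weak limits. -/
structure IsLipschitzWeight (γ : Measure (EuclideanSpace ℝ (Fin d) × EuclideanSpace ℝ (Fin d)))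
    (f : ℝ → EuclideanSpace ℝ (Fin d) × EuclideanSpace ℝ (Fin d) → ℝ) : Prop where
  measurable : ∀ s, Measurable (f s)
  mem : ∀ s, ∀ᵐ p ∂γ, f s p ∈ Icc (0 : ℝ) 1
  lipschitz : ∀ (ψ : EuclideanSpace ℝ (Fin d) → ℝ) (L : ℝ≥0) (C : ℝ), LipschitzWith L ψ →
    (∀ x, |ψ x| ≤ C) → ∀ s ∈ Icc (0 : ℝ) 1, ∀ r ∈ Icc (0 : ℝ) 1,
      |∫ p, f s p * ψ (chordPoint s p) ∂γ - ∫ p, f r p * ψ (chordPoint r p) ∂γ| ≤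
        L * (∫ p, ‖chordDirection p‖ ∂γ) * |s - r|

namespace IsLipschitzWeight

variable {γ : Measure (EuclideanSpace ℝ (Fin d) × EuclideanSpace ℝ (Fin d))}
  {f : ℝ → EuclideanSpace ℝ (Fin d) × EuclideanSpace ℝ (Fin d) → ℝ}

theorem integrable_mul (hf : IsLipschitzWeight γ f) (s : ℝ)
    {H : EuclideanSpace ℝ (Fin d) × EuclideanSpace ℝ (Fin d) → ℝ} (hH : Integrable H γ) :
    Integrable (fun p => f s p * H p) γ :=
  integrable_weight_mul (hf.measurable s).aestronglyMeasurable (hf.mem s) hH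

theorem abs_integral_sub_integral_le (hf : IsLipschitzWeight γ f) {s : ℝ}
    {H K : EuclideanSpace ℝ (Fin d) × EuclideanSpace ℝ (Fin d) → ℝ} (hH : Integrable H γ)
    (hK : Integrable K γ) :
    |∫ p, f s p * H p ∂γ - ∫ p, f s p * K p ∂γ| ≤ ∫ p, |H p - K p| ∂γ := by
  rw [← integral_sub (hf.integrable_mul s hH) (hf.integrable_mul s hK)]
  simp_rw [← mul_sub]
  exact abs_integral_weight_mul_le (hf.mem s) (hH.sub hK)

variable [IsProbabilityMeasure γ]

/-- The `1` accounts for the explicit time dependence of `w`, the other summand for the motion of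
the weighted law. -/
theorem abs_integral_sub_le (hf : IsLipschitzWeight γ f)
    {w : ℝ × EuclideanSpace ℝ (Fin d) → ℝ} {L : ℝ≥0} {C : ℝ} (hw : LipschitzWith L w)
    (hC : ∀ x, |w x| ≤ C) : ∀ s ∈ Icc (0 : ℝ) 1, ∀ r ∈ Icc (0 : ℝ) 1,
      |∫ p, f s p * w (s, chordPoint s p) ∂γ - ∫ p, f r p * w (r, chordPoint r p) ∂γ| ≤
        L * (1 + ∫ p, ‖chordDirection p‖ ∂γ) * |s - r| := by
  intro s hs r hr
  have hwr : LipschitzWith L fun x => w (r, x) := by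
    refine LipschitzWith.of_dist_le_mul fun x y => ?_
    refine (hw.dist_le_mul _ _).trans (le_of_eq ?_)
    rw [Prod.dist_eq]
    simp
  have h2 := hf.lipschitz _ L C hwr (fun x => hC _) s hs r hr
  have hi : ∀ a b : ℝ, Integrable (fun p => w (a, chordPoint b p)) γ := fun a b =>
    integrable_comp_chordPoint (ψ := fun x => w (a, x))
      (hw.continuous.comp (Continuous.prodMk_right a)) (fun x => hC _) b
  have h1 : |∫ p, f s p * w (s, chordPoint s p) ∂γ - ∫ p, f s p * w (r, chordPoint s p) ∂γ| ≤
      L * |s - r| := by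
    rw [← integral_sub (hf.integrable_mul s (hi s s)) (hf.integrable_mul s (hi r s))]
    simp_rw [← mul_sub]
    refine (abs_integral_weight_mul_le (hf.mem s) ((hi s s).sub (hi r s))).trans ?_
    have : ∫ p, |w (s, chordPoint s p) - w (r, chordPoint s p)| ∂γ ≤ ∫ _, L * |s - r| ∂γ := by
      refine integral_mono ((hi s s).sub (hi r s)).abs (integrable_const _) fun p => ?_
      have := hw.dist_le_mul (s, chordPoint s p) (r, chordPoint s p)
      rw [Prod.dist_eq] at this
      simpa [Real.dist_eq] using this
    simpa using this
  have h3 := abs_sub_le (∫ p, f s p * w (s, chordPoint s p) ∂γ)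
    (∫ p, f s p * w (r, chordPoint s p) ∂γ) (∫ p, f r p * w (r, chordPoint r p) ∂γ)
  calc _ ≤ _ := h3
    _ ≤ L * |s - r| + L * (∫ p, ‖chordDirection p‖ ∂γ) * |s - r| := add_le_add h1 h2
    _ = _ := by ring

/-- The weights are measurable in `p` for each time only; being ultrafilter limits chosen time by
time, they carry no joint measurability. For Lipschitz `w` the integral is nevertheless continuous
in time, and `H` is reached by `L¹` approximation and an almost everywhere convergent subsequence.
-/
theorem aestronglyMeasurable_integral (hf : IsLipschitzWeight γ f)
    {H : ℝ × EuclideanSpace ℝ (Fin d) → ℝ} (hH : Measurable H)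
    (hHi : Integrable (fun z : ℝ × EuclideanSpace ℝ (Fin d) × EuclideanSpace ℝ (Fin d) =>
      H (z.1, chordPoint z.1 z.2)) ((volume.restrict (Icc (0 : ℝ) 1)).prod γ)) :
    AEStronglyMeasurable (fun s => ∫ p, f s p * H (s, chordPoint s p) ∂γ)
      (volume.restrict (Icc (0 : ℝ) 1)) := by
  have hex := fun n : ℕ => exists_lipschitz_chord_approx hH hHi (ε := 1 / ((n : ℝ) + 1))
    (by positivity)
  choose w L C hwL hwC hwε using hex
  have hwi : ∀ n, Integrable (fun z : ℝ × EuclideanSpace ℝ (Fin d) × EuclideanSpace ℝ (Fin d) =>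
      w n (z.1, chordPoint z.1 z.2)) ((volume.restrict (Icc (0 : ℝ) 1)).prod γ) := fun n =>
    Integrable.of_bound ((hwL n).continuous.measurable.comp
      measurable_prodMk_chordPoint).aestronglyMeasurable (C n) (ae_of_all _ fun _ => hwC n _)
  have hgi := fun n => (hHi.sub (hwi n)).abs
  let g : ℕ → ℝ → ℝ := fun n s => ∫ p, |H (s, chordPoint s p) - w n (s, chordPoint s p)| ∂γ
  have hg : ∀ n, Integrable (g n) (volume.restrict (Icc (0 : ℝ) 1)) := fun n =>
    (hgi n).integral_prod_left
  have hg0 : ∀ n s, 0 ≤ g n s := fun n s => integral_nonneg fun _ => abs_nonneg _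
  have hgε : ∀ n, ∫ s in Icc (0 : ℝ) 1, g n s ≤ 1 / ((n : ℝ) + 1) := fun n => by
    refine le_trans (le_of_eq ?_) (hwε n)
    exact (integral_prod _ (hgi n)).symm
  have hmeas : TendstoInMeasure (volume.restrict (Icc (0 : ℝ) 1)) g atTop (fun _ => (0 : ℝ)) := by
    refine tendstoInMeasure_of_tendsto_eLpNorm one_ne_zero (fun n => (hg n).aestronglyMeasurable)
      aestronglyMeasurable_const ?_
    have hb : ∀ n, eLpNorm (g n - fun _ => 0) 1 (volume.restrict (Icc (0 : ℝ) 1)) ≤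
        ENNReal.ofReal (1 / ((n : ℝ) + 1)) := fun n => by
      have h0 : (g n - fun _ => (0 : ℝ)) = g n := by ext; simp
      rw [h0, eLpNorm_one_eq_lintegral_enorm, ← ofReal_integral_norm_eq_lintegral_enorm (hg n)]
      refine ENNReal.ofReal_le_ofReal ?_
      simp_rw [Real.norm_eq_abs, abs_of_nonneg (hg0 n _)]
      exact hgε n
    refine tendsto_of_tendsto_of_tendsto_of_le_of_le tendsto_const_nhds ?_ (fun _ => zero_le) hb
    have := ENNReal.tendsto_ofReal (tendsto_one_div_add_atTop_nhds_zero_nat (𝕜 := ℝ))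
    simpa using this
  obtain ⟨ns, -, hns⟩ := hmeas.exists_seq_tendsto_ae
  refine aestronglyMeasurable_of_tendsto_ae (u := atTop)
    (f := fun n s => ∫ p, f s p * w (ns n) (s, chordPoint s p) ∂γ) (fun n => ?_) ?_
  · exact (continuousOn_of_abs_sub_le (hf.abs_integral_sub_le (hwL (ns n))
      (hwC (ns n)))).aestronglyMeasurable measurableSet_Icc
  · filter_upwards [hns, hHi.prod_right_ae] with s hs hsi
    refine tendsto_iff_dist_tendsto_zero.2 (squeeze_zero (fun _ => dist_nonneg) (fun n => ?_) hs)
    rw [dist_comm, Real.dist_eq]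
    refine hf.abs_integral_sub_integral_le hsi ?_
    exact integrable_comp_chordPoint (ψ := fun x => w (ns n) (s, x))
      ((hwL _).continuous.comp (Continuous.prodMk_right s)) (fun x => hwC _ _) s

theorem integrable_integral (hf : IsLipschitzWeight γ f)
    {H : ℝ × EuclideanSpace ℝ (Fin d) → ℝ} (hH : Measurable H)
    (hHi : Integrable (fun z : ℝ × EuclideanSpace ℝ (Fin d) × EuclideanSpace ℝ (Fin d) =>
      H (z.1, chordPoint z.1 z.2)) ((volume.restrict (Icc (0 : ℝ) 1)).prod γ)) :
    Integrable (fun s => ∫ p, f s p * H (s, chordPoint s p) ∂γ)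
      (volume.restrict (Icc (0 : ℝ) 1)) := by
  refine hHi.abs.integral_prod_left.mono' (hf.aestronglyMeasurable_integral hH hHi) ?_
  filter_upwards [hHi.prod_right_ae] with s hs
  exact abs_integral_weight_mul_le (hf.mem s) hs

theorem abs_intervalIntegral_sub_le (hf : IsLipschitzWeight γ f)
    {H K : ℝ × EuclideanSpace ℝ (Fin d) → ℝ}
    (hH : Measurable H) (hK : Measurable K)
    (hHi : Integrable (fun z : ℝ × EuclideanSpace ℝ (Fin d) × EuclideanSpace ℝ (Fin d) =>
      H (z.1, chordPoint z.1 z.2)) ((volume.restrict (Icc (0 : ℝ) 1)).prod γ))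
    (hKi : Integrable (fun z : ℝ × EuclideanSpace ℝ (Fin d) × EuclideanSpace ℝ (Fin d) =>
      K (z.1, chordPoint z.1 z.2)) ((volume.restrict (Icc (0 : ℝ) 1)).prod γ)) {τ : ℝ}
    (hτ : τ ∈ Icc (0 : ℝ) 1) :
    |(∫ s in (0 : ℝ)..τ, ∫ p, f s p * H (s, chordPoint s p) ∂γ) -
      ∫ s in (0 : ℝ)..τ, ∫ p, f s p * K (s, chordPoint s p) ∂γ| ≤
      ∫ z, |H (z.1, chordPoint z.1 z.2) - K (z.1, chordPoint z.1 z.2)|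
        ∂((volume.restrict (Icc (0 : ℝ) 1)).prod γ) := by
  have hsub : Ioc 0 τ ⊆ Icc (0 : ℝ) 1 :=
    Ioc_subset_Icc_self.trans (Icc_subset_Icc_right hτ.2)
  have h1 : IntegrableOn _ _ _ := hf.integrable_integral hH hHi
  have h2 : IntegrableOn _ _ _ := hf.integrable_integral hK hKi
  have h3 := (hHi.sub hKi).abs
  simp only [Pi.sub_def] at h3
  rw [intervalIntegral.integral_of_le hτ.1, intervalIntegral.integral_of_le hτ.1,
    ← integral_sub (h1.mono_set hsub) (h2.mono_set hsub), ← Real.norm_eq_abs]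
  rw [integral_prod _ h3]
  have h4 := h3.integral_prod_left
  calc _ ≤ ∫ s in Ioc 0 τ, ∫ p, |H (s, chordPoint s p) - K (s, chordPoint s p)| ∂γ := by
        refine norm_integral_le_of_norm_le (IntegrableOn.mono_set h4 hsub) ?_
        refine ae_restrict_of_ae_restrict_of_subset hsub ?_
        filter_upwards [hHi.prod_right_ae, hKi.prod_right_ae] with s hs1 hs2
        exact hf.abs_integral_sub_integral_le hs1 hs2
    _ ≤ _ := setIntegral_mono_set h4
        (ae_of_all _ fun s => integral_nonneg fun _ => abs_nonneg _) hsub.eventuallyLE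

/-- Time integrals pass to the limit in weakly convergent families of Lipschitz weights. -/
theorem tendsto_intervalIntegral {ι : Type*} {l : Filter ι} [l.NeBot]
    {F : ι → ℝ → EuclideanSpace ℝ (Fin d) × EuclideanSpace ℝ (Fin d) → ℝ}
    (hF : ∀ i, IsLipschitzWeight γ (F i)) (hf : IsLipschitzWeight γ f)
    (hlim : ∀ s H, Integrable H γ → Tendsto (fun i => ∫ p, F i s p * H p ∂γ) l
      (𝓝 (∫ p, f s p * H p ∂γ)))
    {H : ℝ × EuclideanSpace ℝ (Fin d) → ℝ} (hH : Measurable H)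
    (hHi : Integrable (fun z : ℝ × EuclideanSpace ℝ (Fin d) × EuclideanSpace ℝ (Fin d) =>
      H (z.1, chordPoint z.1 z.2)) ((volume.restrict (Icc (0 : ℝ) 1)).prod γ)) {τ : ℝ}
    (hτ : τ ∈ Icc (0 : ℝ) 1) :
    Tendsto (fun i => ∫ s in (0 : ℝ)..τ, ∫ p, F i s p * H (s, chordPoint s p) ∂γ) l
      (𝓝 (∫ s in (0 : ℝ)..τ, ∫ p, f s p * H (s, chordPoint s p) ∂γ)) := by
  refine tendsto_of_forall_approx fun ε hε => ?_
  -- The error of exchanging `H` for `w` is the same for all `i`, and for `w` the integrands are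
  -- equi-Lipschitz in time.
  obtain ⟨w, L, C, hwL, hwC, hwε⟩ := exists_lipschitz_chord_approx hH hHi hε
  have hwm := hwL.continuous.measurable
  have hwi : Integrable (fun z : ℝ × EuclideanSpace ℝ (Fin d) × EuclideanSpace ℝ (Fin d) =>
      w (z.1, chordPoint z.1 z.2)) ((volume.restrict (Icc (0 : ℝ) 1)).prod γ) :=
    Integrable.of_bound (hwm.comp measurable_prodMk_chordPoint).aestronglyMeasurable C
      (ae_of_all _ fun _ => hwC _)
  refine ⟨_, _, Filter.Eventually.of_forall fun i =>
    ((hF i).abs_intervalIntegral_sub_le hH hwm hHi hwi hτ).trans hwε,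
    (hf.abs_intervalIntegral_sub_le hH hwm hHi hwi hτ).trans hwε, ?_⟩
  refine tendsto_intervalIntegral_of_equiLipschitz (fun i =>
    (hF i).abs_integral_sub_le hwL hwC) (fun s _ => hlim s _ ?_) hτ
  exact integrable_comp_chordPoint (ψ := fun x => w (s, x))
    (hwL.continuous.comp (Continuous.prodMk_right s)) (fun x => hwC _) s

end IsLipschitzWeight

end Limit


/-! ### The solution dominated by the interpolant -/

section Subsolution

variable {d : ℕ} {γ : Measure (EuclideanSpace ℝ (Fin d) × EuclideanSpace ℝ (Fin d))}
  [IsProbabilityMeasure γ] {B : Set (EuclideanSpace ℝ (Fin d))}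
  {v : ℝ → EuclideanSpace ℝ (Fin d) → EuclideanSpace ℝ (Fin d)}

theorem isLipschitzWeight_schemeWeight {t : ℕ → ℝ} {k : ℝ → ℕ} (hg : IsTimeGrid t k)
    (hB : MeasurableSet B) (hint : Integrable chordDirection γ) :
    IsLipschitzWeight γ fun s => schemeWeight γ t B (k s) where
  measurable s := measurable_schemeWeight hB (k s)
  mem s := schemeWeight_mem hB (k s)
  lipschitz ψ L C hψ hC s hs r hr := by
    rcases le_total r s with h | h
    · rw [abs_of_nonneg (sub_nonneg.2 h)]
      exact abs_integral_schemeWeight_sub_le hg hB hint hψ hC hr.1 h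
    · rw [abs_sub_comm, abs_sub_comm s, abs_of_nonneg (sub_nonneg.2 h)]
      exact abs_integral_schemeWeight_sub_le hg hB hint hψ hC hs.1 h

/-- Redrawing at time `0` conditions on the starting point, of which the initial indicator is
already a function. This covers grids that repeat the time `0`. -/
theorem schemeWeight_ae_eq_of_eq_zero {t : ℕ → ℝ} {k : ℝ → ℕ} (hg : IsTimeGrid t k)
    (hB : MeasurableSet B) (j : ℕ) (hj : t j = 0) :
    schemeWeight γ t B j =ᵐ[γ] (Prod.fst ⁻¹' B).indicator fun _ => (1 : ℝ) := by
  have hfst : chordPoint (d := d) 0 = Prod.fst := by ext1 p; simp [chordPoint]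
  induction j with
  | zero => rw [schemeWeight, hj, hfst]; rfl
  | succ j ih =>
    have h0 : t j = 0 := le_antisymm ((hg.mono (Nat.le_succ j)).trans_eq hj) (hg.nonneg j)
    rw [schemeWeight, hj]
    refine (condExp_congr_ae (ih h0)).trans ?_
    rw [condExp_of_stronglyMeasurable (measurable_chordPoint 0).comap_le]
    · refine stronglyMeasurable_const.indicator ⟨B, hB, ?_⟩
      rw [hfst]
    · exact (integrable_const _).indicator (measurable_fst hB)

/-- Dominated convergence: the grid times tend to the actual time, the gradient is continuous, and
`2 * C` times the second factor dominates. -/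
theorem tendsto_integral_fderiv_point_sub {t : ℕ → ℕ → ℝ} {k : ℕ → ℝ → ℕ}
    (hg : ∀ n, IsTimeGrid (t n) (k n))
    (hmesh : ∀ n j, t n (j + 1) - t n j ≤ 1 / ((n : ℝ) + 1))
    (hint : Integrable chordDirection γ) (hv : IsBarycentricVelocity γ v)
    {φ : EuclideanSpace ℝ (Fin d) → ℝ} (hφ : ContDiff ℝ ∞ φ) {C : ℝ}
    (hC : ∀ x, ‖fderiv ℝ φ x‖ ≤ C) :
    Tendsto (fun n => ∫ z, ‖fderiv ℝ φ (chordPoint z.1 z.2) -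
        fderiv ℝ φ (chordPoint (t n (k n z.1)) z.2)‖ *
        (‖chordDirection z.2‖ + ‖v z.1 (chordPoint z.1 z.2)‖)
        ∂((volume.restrict (Icc (0 : ℝ) 1)).prod γ)) atTop (𝓝 0) := by
  have hD : Integrable (fun z : ℝ × EuclideanSpace ℝ (Fin d) × EuclideanSpace ℝ (Fin d) =>
      ‖chordDirection z.2‖ + ‖v z.1 (chordPoint z.1 z.2)‖)
      ((volume.restrict (Icc (0 : ℝ) 1)).prod γ) :=
    (hint.comp_snd _).norm.add hv.integrable_prod.norm
  rw [show 𝓝 (0 : ℝ) = 𝓝 (∫ _, 0 ∂((volume.restrict (Icc (0 : ℝ) 1)).prod γ)) by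
    rw [integral_zero]]
  refine tendsto_integral_of_dominated_convergence _
    (fun n => (integrable_fderiv_point_sub_mul (hg n) hint hv hφ hC).aestronglyMeasurable)
    (hD.const_mul (C + C)) (fun n => ae_of_all _ fun z => ?_) ?_
  · rw [norm_mul, norm_norm, Real.norm_of_nonneg (by positivity : (0 : ℝ) ≤
      ‖chordDirection z.2‖ + ‖v z.1 (chordPoint z.1 z.2)‖)]
    exact mul_le_mul_of_nonneg_right ((norm_sub_le _ _).trans (add_le_add (hC _) (hC _)))
      (by positivity)
  · have hmem : ∀ᵐ z ∂((volume.restrict (Icc (0 : ℝ) 1)).prod γ), z.1 ∈ Icc (0 : ℝ) 1 :=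
      Measure.quasiMeasurePreserving_fst.ae (ae_restrict_mem measurableSet_Icc)
    filter_upwards [hmem] with z hz
    have hκ : Tendsto (fun n => t n (k n z.1)) atTop (𝓝 z.1) := by
      refine tendsto_iff_dist_tendsto_zero.2 (squeeze_zero (fun _ => dist_nonneg) (fun n => ?_)
        (tendsto_one_div_add_atTop_nhds_zero_nat (𝕜 := ℝ)))
      have h1 := (hg n).le z.1 hz.1
      have h2 := (hg n).lt z.1 hz.1
      have h3 := hmesh n (k n z.1)
      rw [dist_comm, Real.dist_eq, abs_of_nonneg (by linarith)]
      linarith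
    have hcont : Continuous fun s => fderiv ℝ φ (chordPoint s z.2) :=
      (hφ.continuous_fderiv (by simp)).comp
        (continuous_chordPoint_uncurry.comp (Continuous.prodMk_left z.2))
    have := (((hcont.tendsto z.1).comp hκ).const_sub
      (fderiv ℝ φ (chordPoint z.1 z.2))).norm.mul_const (‖chordDirection z.2‖ + ‖v z.1 (chordPoint z.1 z.2)‖)
    simpa using this

/-- `f` weights the chords so that the laws of the interpolant under the weights solve the
continuity equation of `v` and start from the restriction of the initial law to `B`. -/
structure IsWeightSolution (γ : Measure (EuclideanSpace ℝ (Fin d) × EuclideanSpace ℝ (Fin d)))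
    (v : ℝ → EuclideanSpace ℝ (Fin d) → EuclideanSpace ℝ (Fin d))
    (B : Set (EuclideanSpace ℝ (Fin d)))
    (f : ℝ → EuclideanSpace ℝ (Fin d) × EuclideanSpace ℝ (Fin d) → ℝ) : Prop where
  isLipschitzWeight : IsLipschitzWeight γ f
  initial : f 0 =ᵐ[γ] (Prod.fst ⁻¹' B).indicator fun _ => (1 : ℝ)
  evolution : ∀ φ : EuclideanSpace ℝ (Fin d) → ℝ, ContDiff ℝ ∞ φ → HasCompactSupport φ →
    IntegrableOn (fun s => ∫ p, f s p * fderiv ℝ φ (chordPoint s p) (v s (chordPoint s p)) ∂γ)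
      (Icc 0 1) ∧
    ∀ τ ∈ Icc (0 : ℝ) 1,
      ∫ p, f τ p * φ (chordPoint τ p) ∂γ - ∫ p, f 0 p * φ (chordPoint 0 p) ∂γ =
        ∫ s in (0 : ℝ)..τ, ∫ p, f s p * fderiv ℝ φ (chordPoint s p) (v s (chordPoint s p)) ∂γ

/-- Among the curves dominated by the laws of the interpolant there is a solution of the continuity
equation which starts from the restriction of the initial law to `B`. -/
theorem exists_weight_solution (hB : MeasurableSet B) (hint : Integrable chordDirection γ)
    (hv : IsBarycentricVelocity γ v) :
    ∃ f, IsWeightSolution γ v B f := by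
  have hex := fun n : ℕ => exists_timeGrid_lintegral_sub_le γ
    (V := fun s p => v s (chordPoint s p)) hv.measurable_chord ENNReal.ofReal_ne_top
    (fun s hs => hv.lintegral_enorm_le hs) (ε := 1 / ((n : ℝ) + 1)) (by positivity)
  choose t k hg hmesh herr using hex
  -- One ultrafilter serves all times and all test functions.
  let l : Ultrafilter ℕ := hyperfilter ℕ
  have hl : (l : Filter ℕ) ≤ atTop := Nat.hyperfilter_le_atTop
  have hF : ∀ n, IsLipschitzWeight γ fun s => schemeWeight γ (t n) B (k n s) := fun n =>
    isLipschitzWeight_schemeWeight (hg n) hB hint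
  have hlimex := fun s : ℝ => exists_weak_limit l (fun n => schemeWeight γ (t n) B (k n s))
    (fun n => ((hF n).measurable s).aestronglyMeasurable) (fun n => (hF n).mem s)
  choose f hfm hf01 hlim using hlimex
  have hf : IsLipschitzWeight γ f := by
    refine ⟨hfm, fun s => ae_of_all _ (hf01 s), fun ψ L C hψ hC => ?_⟩
    refine lipschitzOnWith_of_tendsto (l := (l : Filter ℕ))
      (fun n => (hF n).lipschitz ψ L C hψ hC) fun s _ => ?_
    exact hlim s _ (integrable_comp_chordPoint hψ.continuous hC s)
  refine ⟨f, hf, ?_, fun φ hφ hc => ?_⟩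
  · have h0 : ∀ H, Integrable H γ → ∫ p, f 0 p * H p ∂γ =
        ∫ p, (Prod.fst ⁻¹' B).indicator (fun _ => (1 : ℝ)) p * H p ∂γ := by
      intro H hH
      refine tendsto_nhds_unique (hlim 0 H hH) (tendsto_const_nhds.congr fun n => ?_)
      refine integral_congr_ae ?_
      filter_upwards [schemeWeight_ae_eq_of_eq_zero (γ := γ) (hg n) hB (k n 0)
        (hg n).index_zero_of_pos] with p hp
      rw [hp]
    have hi1 : Integrable ((Prod.fst ⁻¹' B).indicator fun _ => (1 : ℝ)) γ :=
      (integrable_const _).indicator (measurable_fst hB)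
    have hi2 : Integrable (f 0) γ := by simpa using hf.integrable_mul 0 (integrable_const (1 : ℝ))
    refine hi2.ae_eq_of_forall_setIntegral_eq _ _ hi1 fun s hs _ => ?_
    have := h0 (s.indicator fun _ => 1) ((integrable_const _).indicator hs)
    simp only [← Set.indicator_mul_right, mul_one, integral_indicator hs] at this
    exact this
  · obtain ⟨C, hC0, hC, -⟩ := fderiv_bounded_of_hasCompactSupport hφ hc
    obtain ⟨C', hC'⟩ := hc.exists_bound_of_continuous hφ.continuous
    have hcont := hφ.continuous_fderiv (by simp)
    let H : ℝ × EuclideanSpace ℝ (Fin d) → ℝ := fun x => fderiv ℝ φ x.2 (v x.1 x.2)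
    have hH : Measurable H := by
      have h1 : Measurable fun x : ℝ × EuclideanSpace ℝ (Fin d) => fderiv ℝ φ x.2 :=
        hcont.measurable.comp measurable_snd
      exact isBoundedBilinearMap_apply.continuous.measurable.comp (h1.prodMk hv.measurable)
    have hHi : Integrable (fun z : ℝ × EuclideanSpace ℝ (Fin d) × EuclideanSpace ℝ (Fin d) =>
        H (z.1, chordPoint z.1 z.2)) ((volume.restrict (Icc (0 : ℝ) 1)).prod γ) := by
      have h2 : Continuous fun z : ℝ × EuclideanSpace ℝ (Fin d) × EuclideanSpace ℝ (Fin d) =>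
        fderiv ℝ φ (chordPoint z.1 z.2) := hcont.comp continuous_chordPoint_uncurry
      exact integrable_clm_apply h2.aestronglyMeasurable (fun z => hC _) hv.integrable_prod
    refine ⟨hf.integrable_integral hH hHi, fun τ hτ => ?_⟩
    have hφi := integrable_comp_chordPoint (γ := γ) hφ.continuous hC'
    have h1 := (hlim τ _ (hφi τ)).sub (hlim 0 _ (hφi 0))
    have h2 := IsLipschitzWeight.tendsto_intervalIntegral hF hf (fun s H hH => hlim s H hH) hH
      hHi hτ
    -- The left side of the scheme's evolution equation converges to that of the limit. Its right
    -- side differs from the velocity integral by a vanishing error, and the velocity integral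
    -- converges.
    refine tendsto_nhds_unique h1 ?_
    have hdiff : Tendsto (fun n => (∫ s in (0 : ℝ)..τ, ∫ p, schemeWeight γ (t n) B (k n s) p *
          fderiv ℝ φ (chordPoint s p) (chordDirection p) ∂γ) -
        ∫ s in (0 : ℝ)..τ, ∫ p, schemeWeight γ (t n) B (k n s) p *
          fderiv ℝ φ (chordPoint s p) (v s (chordPoint s p)) ∂γ) atTop (𝓝 0) := by
      have hb := (tendsto_integral_fderiv_point_sub hg hmesh hint hv hφ hC).add
        ((tendsto_one_div_add_atTop_nhds_zero_nat (𝕜 := ℝ)).const_mul C)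
      rw [mul_zero, add_zero] at hb
      refine squeeze_zero_norm (fun n => ?_) hb
      rw [Real.norm_eq_abs]
      exact abs_intervalIntegral_schemeWeight_sub_le (hg n) hB hint hv hφ hc hC (by positivity)
        (herr n) hτ
    have h3 := (hdiff.mono_left hl).add h2
    rw [zero_add] at h3
    refine h3.congr fun n => ?_
    rw [integral_schemeWeight_sub_eq (hg n) hB hint hφ hc hτ.1]
    simp only [H]
    ring

end Subsolution


/-! ### Measurable version and weak equation of the flow -/

section Flow

variable {d : ℕ} {μ₀ : Measure (EuclideanSpace ℝ (Fin d))}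
  {v X : ℝ → EuclideanSpace ℝ (Fin d) → EuclideanSpace ℝ (Fin d)}

theorem continuousOn_of_eq_add_integral {E : Type*} [NormedAddCommGroup E] [NormedSpace ℝ E]
    {x g : ℝ → E} {u : E} (hg : IntervalIntegrable g volume 0 1)
    (hx : ∀ τ ∈ Icc (0 : ℝ) 1, x τ = u + ∫ s in (0 : ℝ)..τ, g s) : ContinuousOn x (Icc 0 1) := by
  have h := intervalIntegral.continuousOn_primitive_interval (μ := volume) (f := g)
    (a := 0) (b := 1) (by rwa [uIcc_of_le zero_le_one, ← intervalIntegrable_iff_integrableOn_Icc_of_le zero_le_one])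
  rw [uIcc_of_le zero_le_one] at h
  exact (continuousOn_const.add h).congr hx

/-- A flow has a version which is jointly measurable and continuous in time. -/
theorem IsFlow.exists_measurable_version (hX : IsFlow μ₀ v X) :
    ∃ Y : ℝ → EuclideanSpace ℝ (Fin d) → EuclideanSpace ℝ (Fin d),
      Measurable (Function.uncurry Y) ∧ (∀ u, Continuous fun s => Y s u) ∧
      (∀ᵐ u ∂μ₀, ∀ τ ∈ Icc (0 : ℝ) 1, Y τ u = X τ u) ∧ IsFlow μ₀ v Y := by
  classical
  -- Each `X τ` is measurable only up to a null set depending on `τ`. Countably many dense times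
  -- share one null set, and continuity of the curves recovers the others.
  let q : ℕ → Icc (0 : ℝ) 1 := TopologicalSpace.denseSeq (Icc (0 : ℝ) 1)
  have hq : ∀ᵐ u ∂μ₀, ∀ n, X (q n) u = (hX.aemeasurable (q n) (q n).2).mk _ u :=
    ae_all_iff.2 fun n => (hX.aemeasurable (q n) (q n).2).ae_eq_mk
  obtain ⟨S, hS, hSm, hSμ⟩ := exists_measurable_superset_of_null
    (s := {u | (IntervalIntegrable (fun s => v s (X s u)) volume 0 1 ∧
      ∀ τ ∈ Icc (0 : ℝ) 1, X τ u = u + ∫ s in (0 : ℝ)..τ, v s (X s u)) ∧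
      ∀ n, X (q n) u = (hX.aemeasurable (q n) (q n).2).mk _ u}ᶜ) (hX.integralCurve.and hq)
  have hSc : ∀ u, u ∉ S → _ := fun u hu => notMem_compl_iff.1 (fun h => hu (hS h))
  -- On the exceptional set the curve is made constant; outside `[0, 1]` time is clamped.
  let Y : ℝ → EuclideanSpace ℝ (Fin d) → EuclideanSpace ℝ (Fin d) := fun s u =>
    if u ∈ S then u else X (projIcc 0 1 zero_le_one s) u
  have hYcont : ∀ u, Continuous fun s => Y s u := by
    intro u
    by_cases hu : u ∈ S
    · simp only [Y, if_pos hu]; exact continuous_const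
    · simp only [Y, if_neg hu]
      have h1 := continuousOn_of_eq_add_integral (hSc u hu).1.1 (hSc u hu).1.2
      exact h1.comp_continuous (continuous_subtype_val.comp continuous_projIcc)
        fun s => (projIcc 0 1 zero_le_one s).2
  have hYq : ∀ n, Measurable (Y (q n)) := by
    intro n
    have : Y (q n) = fun u => if u ∈ S then u else (hX.aemeasurable (q n) (q n).2).mk _ u := by
      ext1 u
      simp only [Y, projIcc_val]
      split_ifs with h
      · rfl
      · exact (hSc u h).2 n
    rw [this]
    exact Measurable.ite hSm measurable_id (hX.aemeasurable (q n) (q n).2).measurable_mk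
  have hYm : ∀ s, Measurable (Y s) := by
    intro s
    obtain ⟨x, hx, hxl⟩ := mem_closure_iff_seq_limit.1
      (TopologicalSpace.denseRange_denseSeq (Icc (0 : ℝ) 1) (projIcc 0 1 zero_le_one s))
    choose m hm using hx
    refine measurable_of_tendsto_metrizable (fun n => hYq (m n)) (tendsto_pi_nhds.2 fun u => ?_)
    have h1 : Y s u = Y (projIcc 0 1 zero_le_one s) u := by simp only [Y, projIcc_val]
    rw [h1]
    refine ((hYcont u).tendsto _).comp ?_
    have := (continuous_subtype_val.tendsto _).comp hxl
    refine this.congr fun n => ?_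
    simp only [Function.comp_apply, q, hm]
  have hYX : ∀ᵐ u ∂μ₀, ∀ τ ∈ Icc (0 : ℝ) 1, Y τ u = X τ u := by
    have : ∀ᵐ u ∂μ₀, u ∉ S := measure_eq_zero_iff_ae_notMem.1 hSμ
    filter_upwards [this] with u hu τ hτ
    simp only [Y, if_neg hu, projIcc_of_mem zero_le_one hτ]
  refine ⟨Y, measurable_uncurry_of_continuous_of_measurable hYcont hYm, hYcont, hYX,
    fun τ _ => (hYm τ).aemeasurable, ?_⟩
  filter_upwards [hYX, hX.integralCurve] with u h1 h2
  constructor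
  · refine h2.1.congr fun s hs => ?_
    rw [h1 s (by rw [uIoc_of_le zero_le_one] at hs; exact Ioc_subset_Icc_self hs)]
  · intro τ hτ
    rw [h1 τ hτ, h2.2 τ hτ]
    congr 1
    refine intervalIntegral.integral_congr fun s hs => ?_
    rw [uIcc_of_le hτ.1] at hs
    rw [h1 s ⟨hs.1, hs.2.trans hτ.2⟩]

variable [IsProbabilityMeasure μ₀] {Y : ℝ → EuclideanSpace ℝ (Fin d) → EuclideanSpace ℝ (Fin d)}
  {A : Set (EuclideanSpace ℝ (Fin d))}

theorem integrable_velocity_flow (hv : Measurable (Function.uncurry v))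
    (hYm : Measurable (Function.uncurry Y)) {M : ℝ≥0∞} (hM : M ≠ ⊤)
    (hAM : ∀ u ∈ A, ∫⁻ s in Icc (0 : ℝ) 1, ‖v s (Y s u)‖ₑ ≤ M) :
    Integrable (fun z : ℝ × EuclideanSpace ℝ (Fin d) => v z.1 (Y z.1 z.2))
      ((volume.restrict (Icc (0 : ℝ) 1)).prod (μ₀.restrict A)) := by
  have hm : Measurable fun z : ℝ × EuclideanSpace ℝ (Fin d) => v z.1 (Y z.1 z.2) :=
    hv.comp (measurable_fst.prodMk hYm)
  refine ⟨hm.aestronglyMeasurable, ?_⟩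
  rw [hasFiniteIntegral_iff_enorm, lintegral_prod_symm _ hm.enorm.aemeasurable]
  refine (setLIntegral_mono measurable_const hAM).trans_lt ?_
  rw [setLIntegral_const]
  exact ENNReal.mul_lt_top hM.lt_top (measure_lt_top _ _)

/-- The laws of a flow, restricted to initial points along whose curves the velocity is uniformly
integrable, satisfy the continuity equation. -/
theorem flow_weak_eq (hv : Measurable (Function.uncurry v))
    (hYm : Measurable (Function.uncurry Y)) (hY : IsFlow μ₀ v Y) {M : ℝ≥0∞}
    (hM : M ≠ ⊤) (hAM : ∀ u ∈ A, ∫⁻ s in Icc (0 : ℝ) 1, ‖v s (Y s u)‖ₑ ≤ M)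
    {φ : EuclideanSpace ℝ (Fin d) → ℝ} (hφ : ContDiff ℝ ∞ φ) (hc : HasCompactSupport φ) :
    IntegrableOn (fun s => ∫ u in A, fderiv ℝ φ (Y s u) (v s (Y s u)) ∂μ₀) (Icc 0 1) ∧
    ∀ τ ∈ Icc (0 : ℝ) 1, ∫ u in A, φ (Y τ u) ∂μ₀ - ∫ u in A, φ u ∂μ₀ =
      ∫ s in (0 : ℝ)..τ, ∫ u in A, fderiv ℝ φ (Y s u) (v s (Y s u)) ∂μ₀ := by
  obtain ⟨C, hC0, hC, -⟩ := fderiv_bounded_of_hasCompactSupport hφ hc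
  obtain ⟨C', hC'⟩ := hc.exists_bound_of_continuous hφ.continuous
  have hi : Integrable (fun z : ℝ × EuclideanSpace ℝ (Fin d) =>
      fderiv ℝ φ (Y z.1 z.2) (v z.1 (Y z.1 z.2)))
      ((volume.restrict (Icc (0 : ℝ) 1)).prod (μ₀.restrict A)) := by
    have h1 : Measurable fun z : ℝ × EuclideanSpace ℝ (Fin d) => fderiv ℝ φ (Y z.1 z.2) :=
      (hφ.continuous_fderiv (by simp)).measurable.comp hYm
    exact integrable_clm_apply h1.aestronglyMeasurable (fun _ => hC _)
      (integrable_velocity_flow hv hYm hM hAM)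
  refine ⟨hi.integral_prod_left, fun τ hτ => ?_⟩
  have hφi : ∀ g : EuclideanSpace ℝ (Fin d) → EuclideanSpace ℝ (Fin d), Measurable g →
      Integrable (fun u => φ (g u)) (μ₀.restrict A) := fun g hg =>
    Integrable.of_bound (hφ.continuous.measurable.comp hg).aestronglyMeasurable C'
      (ae_of_all _ fun _ => hC' _)
  rw [← integral_sub (hφi (Y τ) (hYm.comp measurable_prodMk_left)) (hφi (fun u => u) measurable_id),
    intervalIntegral.integral_of_le hτ.1]
  have hsub : Ioc 0 τ ⊆ Icc (0 : ℝ) 1 :=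
    Ioc_subset_Icc_self.trans (Icc_subset_Icc_right hτ.2)
  have hi' : Integrable (Function.uncurry fun s u => fderiv ℝ φ (Y s u) (v s (Y s u)))
      ((volume.restrict (Ioc 0 τ)).prod (μ₀.restrict A)) := by
    rw [Measure.prod_restrict] at hi ⊢
    exact IntegrableOn.mono_set hi (prod_mono hsub le_rfl)
  rw [integral_integral_swap hi']
  refine integral_congr_ae ?_
  filter_upwards [ae_restrict_of_ae hY.integralCurve] with u hu
  rw [← intervalIntegral.integral_of_le hτ.1]
  refine (integral_fderiv_comp_primitive (x := fun s => Y s u) (g := fun s => v s (Y s u))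
    hφ hc hτ.1 (hu.1.mono_set ?_) fun t ht => ?_).symm
  · rw [uIcc_of_le hτ.1, uIcc_of_le zero_le_one]
    exact Icc_subset_Icc_right hτ.2
  · exact hu.2 t ⟨ht.1, ht.2.trans hτ.2⟩

end Flow

/-! ### Gluing the truncated flow to the dominated solution -/

section Gluing

variable {d : ℕ}

/-- The law of the flow started from `μ₀` restricted to `A`, plus the law of the interpolant under
the weights `f`. -/
noncomputable def gluedLaw (μ₀ : Measure (EuclideanSpace ℝ (Fin d)))
    (γ : Measure (EuclideanSpace ℝ (Fin d) × EuclideanSpace ℝ (Fin d)))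
    (A : Set (EuclideanSpace ℝ (Fin d)))
    (Y : ℝ → EuclideanSpace ℝ (Fin d) → EuclideanSpace ℝ (Fin d))
    (f : ℝ → EuclideanSpace ℝ (Fin d) × EuclideanSpace ℝ (Fin d) → ℝ) (τ : ℝ) :
    Measure (EuclideanSpace ℝ (Fin d)) :=
  (μ₀.restrict A).map (Y τ) +
    (γ.withDensity fun p => ((f τ p).toNNReal : ℝ≥0∞)).map (chordPoint τ)

variable {μ₀ : Measure (EuclideanSpace ℝ (Fin d))}
  {γ : Measure (EuclideanSpace ℝ (Fin d) × EuclideanSpace ℝ (Fin d))}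
  {v Y : ℝ → EuclideanSpace ℝ (Fin d) → EuclideanSpace ℝ (Fin d)}
  {A : Set (EuclideanSpace ℝ (Fin d))}
  {f : ℝ → EuclideanSpace ℝ (Fin d) × EuclideanSpace ℝ (Fin d) → ℝ}

theorem withDensity_le_of_isLipschitzWeight (hf : IsLipschitzWeight γ f) (τ : ℝ) :
    (γ.withDensity fun p => ((f τ p).toNNReal : ℝ≥0∞)) ≤ γ := by
  conv_rhs => rw [← withDensity_one (μ := γ)]
  refine withDensity_mono ?_
  filter_upwards [hf.mem τ] with p hp
  simpa using hp.2

theorem integral_gluedLaw (hYm : Measurable (Function.uncurry Y)) (hf : IsLipschitzWeight γ f)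
    {τ : ℝ} {g : EuclideanSpace ℝ (Fin d) → ℝ} (hg : Measurable g)
    (h1 : Integrable (fun u => g (Y τ u)) (μ₀.restrict A))
    (h2 : Integrable (fun p => g (chordPoint τ p)) γ) :
    ∫ u, g u ∂(gluedLaw μ₀ γ A Y f τ) =
      ∫ u in A, g (Y τ u) ∂μ₀ + ∫ p, f τ p * g (chordPoint τ p) ∂γ := by
  have hYτ : Measurable (Y τ) := hYm.comp measurable_prodMk_left
  have hUτ := measurable_chordPoint (d := d) τ
  have h2' := h2.mono_measure (withDensity_le_of_isLipschitzWeight hf τ)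
  rw [gluedLaw, integral_add_measure
    ((integrable_map_measure hg.aestronglyMeasurable hYτ.aemeasurable).2 h1)
    ((integrable_map_measure hg.aestronglyMeasurable hUτ.aemeasurable).2 h2'),
    integral_map hYτ.aemeasurable hg.aestronglyMeasurable,
    integral_map hUτ.aemeasurable hg.aestronglyMeasurable,
    integral_withDensity_eq_integral_smul (hf.measurable τ).real_toNNReal]
  congr 1
  refine integral_congr_ae ?_
  filter_upwards [hf.mem τ] with p hp
  rw [NNReal.smul_def, Real.coe_toNNReal _ hp.1, smul_eq_mul]

theorem integral_gluedLaw_of_bounded [IsFiniteMeasure μ₀] [IsProbabilityMeasure γ]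
    (hYm : Measurable (Function.uncurry Y)) (hf : IsLipschitzWeight γ f) (τ : ℝ) {ψ : EuclideanSpace ℝ (Fin d) → ℝ} (hψ : Continuous ψ)
    {C : ℝ} (hC : ∀ x, |ψ x| ≤ C) :
    ∫ u, ψ u ∂(gluedLaw μ₀ γ A Y f τ) =
      ∫ u in A, ψ (Y τ u) ∂μ₀ + ∫ p, f τ p * ψ (chordPoint τ p) ∂γ :=
  integral_gluedLaw hYm hf hψ.measurable
    (Integrable.of_bound (hψ.measurable.comp (hYm.comp measurable_prodMk_left)).aestronglyMeasurable
      C (ae_of_all _ fun _ => hC _)) (integrable_comp_chordPoint hψ hC τ)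

theorem isFiniteMeasure_gluedLaw [IsFiniteMeasure μ₀] [IsFiniteMeasure γ]
    (hf : IsLipschitzWeight γ f) (τ : ℝ) :
    IsFiniteMeasure (gluedLaw μ₀ γ A Y f τ) := by
  have := isFiniteMeasure_of_le _ (withDensity_le_of_isLipschitzWeight hf τ)
  unfold gluedLaw
  infer_instance

/-- Mass is conserved: the constant test function `1` has Lipschitz constant `0`. -/
theorem integral_weight_eq_initial {B : Set (EuclideanSpace ℝ (Fin d))}
    (hf : IsWeightSolution γ v B f) {τ : ℝ} (hτ : τ ∈ Icc (0 : ℝ) 1) :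
    ∫ p, f τ p ∂γ = ∫ p, f 0 p ∂γ := by
  have := hf.isLipschitzWeight.lipschitz (fun _ => 1) 0 1 (LipschitzWith.const _) (by simp) τ hτ 0
    (by simp)
  simp only [mul_one, NNReal.coe_zero, zero_mul] at this
  exact sub_eq_zero.1 (abs_nonpos_iff.1 this)

theorem gluedLaw_zero (hfst : γ.map Prod.fst = μ₀) (hY : IsFlow μ₀ v Y)
    (hA : MeasurableSet A) (hf : IsWeightSolution γ v Aᶜ f) :
    gluedLaw μ₀ γ A Y f 0 = μ₀ := by
  have h1 : (μ₀.restrict A).map (Y 0) = μ₀.restrict A := by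
    have : Y 0 =ᵐ[μ₀.restrict A] id := by
      filter_upwards [ae_restrict_of_ae hY.integralCurve] with u hu
      simpa using hu.2 0 (by simp)
    rw [Measure.map_congr this, Measure.map_id]
  have h2 : (γ.withDensity fun p => ((f 0 p).toNNReal : ℝ≥0∞)) = γ.restrict (Prod.fst ⁻¹' Aᶜ) := by
    rw [← withDensity_indicator_one (measurable_fst hA.compl)]
    refine withDensity_congr_ae ?_
    filter_upwards [hf.initial] with p hp
    rw [hp]
    by_cases h : p ∈ Prod.fst ⁻¹' Aᶜ
    · rw [indicator_of_mem h, indicator_of_mem h]; simp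
    · rw [indicator_of_notMem h, indicator_of_notMem h]; simp
  have h3 : chordPoint (d := d) 0 = Prod.fst := by ext1 p; simp [chordPoint]
  rw [gluedLaw, h1, h2, h3, ← Measure.restrict_map measurable_fst hA.compl, hfst,
    Measure.restrict_add_restrict_compl hA]

theorem isProbabilityMeasure_gluedLaw [IsProbabilityMeasure μ₀] [IsProbabilityMeasure γ]
    (hfst : γ.map Prod.fst = μ₀)
    (hYm : Measurable (Function.uncurry Y))
    (hY : IsFlow μ₀ v Y) (hA : MeasurableSet A) (hf : IsWeightSolution γ v Aᶜ f) {τ : ℝ}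
    (hτ : τ ∈ Icc (0 : ℝ) 1) : IsProbabilityMeasure (gluedLaw μ₀ γ A Y f τ) := by
  have hL := hf.isLipschitzWeight
  have := isFiniteMeasure_gluedLaw (μ₀ := μ₀) (A := A) (Y := Y) hL τ
  have hmass := fun s => integral_gluedLaw_of_bounded (μ₀ := μ₀) (A := A) hYm hL s
    (ψ := fun _ => 1) continuous_const (C := 1) (by simp)
  have h0 := hmass 0
  have h1 := hmass τ
  rw [gluedLaw_zero hfst hY hA hf] at h0
  simp only [mul_one, integral_weight_eq_initial hf hτ] at h0 h1
  rw [← h0] at h1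
  refine ⟨?_⟩
  have h2 : (gluedLaw μ₀ γ A Y f τ).real univ = 1 := by simpa using h1
  rw [measureReal_def] at h2
  exact (ENNReal.toReal_eq_one_iff _).1 h2

end Gluing


/-! ### The glued solution, uniqueness and removal of the truncation -/

section Transport

variable {d : ℕ} {μ₀ : Measure (EuclideanSpace ℝ (Fin d))}
  {γ : Measure (EuclideanSpace ℝ (Fin d) × EuclideanSpace ℝ (Fin d))}
  {v Y : ℝ → EuclideanSpace ℝ (Fin d) → EuclideanSpace ℝ (Fin d)}
  {A : Set (EuclideanSpace ℝ (Fin d))}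
  {f : ℝ → EuclideanSpace ℝ (Fin d) × EuclideanSpace ℝ (Fin d) → ℝ}

/-- The truncation bounds the flow part by `M` times the mass of `A`; the weighted part lies below
the interpolant, which has a finite integral. -/
theorem lintegral_gluedLaw_lt_top [IsProbabilityMeasure μ₀] (hv : IsBarycentricVelocity γ v)
    (hYm : Measurable (Function.uncurry Y)) {M : ℝ≥0∞} (hM : M ≠ ⊤)
    (hAM : ∀ u ∈ A, ∫⁻ s in Icc (0 : ℝ) 1, ‖v s (Y s u)‖ₑ ≤ M) (hf : IsLipschitzWeight γ f) :
    ∫⁻ s in Icc (0 : ℝ) 1, ∫⁻ u, ‖v s u‖ₑ ∂(gluedLaw μ₀ γ A Y f s) < ⊤ := by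
  have hvs : ∀ s, Measurable fun u => ‖v s u‖ₑ := fun s =>
    (hv.measurable.comp measurable_prodMk_left).enorm
  have hpt : ∀ s ∈ Icc (0 : ℝ) 1, ∫⁻ u, ‖v s u‖ₑ ∂(gluedLaw μ₀ γ A Y f s) ≤
      (∫⁻ u in A, ‖v s (Y s u)‖ₑ ∂μ₀) + ENNReal.ofReal (∫ p, ‖chordDirection p‖ ∂γ) := by
    intro s hs
    rw [gluedLaw, lintegral_add_measure,
      lintegral_map (hvs s) (show Measurable (Y s) from hYm.comp measurable_prodMk_left),
      lintegral_map (hvs s) (measurable_chordPoint s)]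
    refine add_le_add le_rfl (le_trans ?_ (hv.lintegral_enorm_le hs))
    exact lintegral_mono' (withDensity_le_of_isLipschitzWeight hf s) le_rfl
  refine (setLIntegral_mono' measurableSet_Icc hpt).trans_lt ?_
  rw [lintegral_add_right _ measurable_const]
  refine ENNReal.add_lt_top.2 ⟨?_, by simp⟩
  have hi := integrable_velocity_flow (μ₀ := μ₀) hv.measurable hYm hM hAM
  have := hi.2
  rw [hasFiniteIntegral_iff_enorm] at this
  rwa [lintegral_prod _ hi.1.enorm] at this

variable [IsProbabilityMeasure γ]

/-- The weights are at most `1` and have total mass `1`, so they equal `1` almost everywhere. The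
interpolant is thereby itself a glued law. -/
theorem gluedLaw_empty (hf : IsWeightSolution γ v ∅ᶜ f) {τ : ℝ} (hτ : τ ∈ Icc (0 : ℝ) 1) :
    gluedLaw μ₀ γ ∅ Y f τ = interpolantLaw γ τ := by
  have hL := hf.isLipschitzWeight
  have hi : ∀ s, Integrable (f s) γ := fun s => by
    simpa using hL.integrable_mul s (integrable_const (1 : ℝ))
  have h0 : ∫ p, f 0 p ∂γ = 1 := by
    rw [integral_congr_ae hf.initial]; simp
  have h1 : ∫ p, (1 - f τ p) ∂γ = 0 := by
    rw [integral_sub (integrable_const _) (hi τ), integral_weight_eq_initial hf hτ, h0]; simp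
  have h2 : (fun p => 1 - f τ p) =ᵐ[γ] 0 := by
    refine (integral_eq_zero_iff_of_nonneg_ae ?_ ((integrable_const _).sub (hi τ))).1 h1
    filter_upwards [hL.mem τ] with p hp
    exact sub_nonneg.2 hp.2
  have h3 : (γ.withDensity fun p => ((f τ p).toNNReal : ℝ≥0∞)) = γ := by
    conv_rhs => rw [← withDensity_one (μ := γ)]
    refine withDensity_congr_ae ?_
    filter_upwards [h2] with p hp
    have : f τ p = 1 := by simp only [Pi.zero_apply] at hp; linarith
    simp [this]
  rw [gluedLaw, h3, Measure.restrict_empty, Measure.map_zero, zero_add, interpolantLaw]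

variable [IsProbabilityMeasure μ₀]

theorem continuousOn_integral_gluedLaw (hYm : Measurable (Function.uncurry Y))
    (hYc : ∀ u, Continuous fun s => Y s u) (hf : IsLipschitzWeight γ f)
    {ψ : EuclideanSpace ℝ (Fin d) → ℝ} {L : ℝ≥0} (hψ : LipschitzWith L ψ) {C : ℝ}
    (hC : ∀ x, |ψ x| ≤ C) :
    ContinuousOn (fun τ => ∫ u, ψ u ∂(gluedLaw μ₀ γ A Y f τ)) (Icc 0 1) := by
  simp_rw [integral_gluedLaw_of_bounded (μ₀ := μ₀) (A := A) hYm hf _ hψ.continuous hC]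
  refine ContinuousOn.add (Continuous.continuousOn ?_)
    (continuousOn_of_abs_sub_le (hf.lipschitz ψ L C hψ hC))
  refine continuous_of_dominated (bound := fun _ => C) (fun τ => ?_)
    (fun τ => ae_of_all _ fun u => hC _) (integrable_const _) (ae_of_all _ fun u => hψ.continuous.comp (hYc u))
  exact (hψ.continuous.measurable.comp (hYm.comp measurable_prodMk_left)).aestronglyMeasurable

/-- The glued laws form a weak solution of the continuity equation. -/
theorem isContinuitySolution_gluedLaw (hfst : γ.map Prod.fst = μ₀) (hv : IsBarycentricVelocity γ v)
    (hYm : Measurable (Function.uncurry Y)) (hYc : ∀ u, Continuous fun s => Y s u)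
    (hY : IsFlow μ₀ v Y) (hA : MeasurableSet A) {M : ℝ≥0∞} (hM : M ≠ ⊤)
    (hAM : ∀ u ∈ A, ∫⁻ s in Icc (0 : ℝ) 1, ‖v s (Y s u)‖ₑ ≤ M) (hf : IsWeightSolution γ v Aᶜ f)
    {σ : ℝ → ProbabilityMeasure (EuclideanSpace ℝ (Fin d))}
    (hσ : ∀ τ ∈ Icc (0 : ℝ) 1,
      (σ τ : Measure (EuclideanSpace ℝ (Fin d))) = gluedLaw μ₀ γ A Y f τ) :
    IsContinuitySolution μ₀ v σ where
  continuousOn := by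
    intro τ hτ
    refine tendsto_iff_forall_lipschitz_integral_tendsto.2 fun ψ ⟨C, hC⟩ ⟨L, hL⟩ => ?_
    -- `C` bounds the oscillation of `ψ`, not its size.
    have hC' : ∀ x, |ψ x| ≤ C + |ψ 0| := fun x => by
      have h1 := hC x 0
      rw [Real.dist_eq] at h1
      linarith [abs_sub_abs_le_abs_sub (ψ x) (ψ 0)]
    have h := continuousOn_integral_gluedLaw (μ₀ := μ₀) (A := A) hYm hYc
      hf.isLipschitzWeight hL hC' τ hτ
    rw [hσ τ hτ]
    refine Tendsto.congr' ?_ h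
    filter_upwards [self_mem_nhdsWithin] with s hs
    rw [hσ s hs]
  initial := by rw [hσ 0 (by simp), gluedLaw_zero hfst hY hA hf]
  integrable := by
    rw [setLIntegral_congr_fun measurableSet_Icc
      (g := fun s => ∫⁻ u, ‖v s u‖ₑ ∂(gluedLaw μ₀ γ A Y f s))
      (fun s hs => by simp only [hσ s hs])]
    exact lintegral_gluedLaw_lt_top hv hYm hM hAM hf.isLipschitzWeight
  weak_eq := by
    intro φ hφ hc τ hτ
    obtain ⟨C, -, hC, -⟩ := fderiv_bounded_of_hasCompactSupport hφ hc
    obtain ⟨C', hC'⟩ := hc.exists_bound_of_continuous hφ.continuous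
    obtain ⟨hi1, he1⟩ := flow_weak_eq hv.measurable hYm hY hM hAM hφ hc
    obtain ⟨hi2, he2⟩ := hf.evolution φ hφ hc
    have hval := fun s => integral_gluedLaw_of_bounded (μ₀ := μ₀) (A := A) hYm
      hf.isLipschitzWeight s hφ.continuous hC'
    have hinit : ∫ u, φ u ∂μ₀ = ∫ u in A, φ u ∂μ₀ + ∫ p, f 0 p * φ (chordPoint 0 p) ∂γ := by
      have h := hval 0
      rw [gluedLaw_zero hfst hY hA hf] at h
      rw [h]
      congr 1
      refine integral_congr_ae ?_
      filter_upwards [ae_restrict_of_ae hY.integralCurve] with u hu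
      have := hu.2 0 (by simp)
      simp only [intervalIntegral.integral_same, add_zero] at this
      rw [this]
    have hvel := integrable_velocity_flow (μ₀ := μ₀) hv.measurable hYm hM hAM
    have hcont := hφ.continuous_fderiv (by simp)
    -- Integrability of the velocity over the flow part at a fixed time comes from Fubini, hence for
    -- almost every `s` only.
    have hint : ∀ᵐ s ∂(volume.restrict (Icc (0 : ℝ) 1)),
        ∫ u, fderiv ℝ φ u (v s u) ∂(σ s : Measure (EuclideanSpace ℝ (Fin d))) =
        ∫ u in A, fderiv ℝ φ (Y s u) (v s (Y s u)) ∂μ₀ +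
          ∫ p, f s p * fderiv ℝ φ (chordPoint s p) (v s (chordPoint s p)) ∂γ := by
      filter_upwards [hvel.prod_right_ae, ae_restrict_mem measurableSet_Icc] with s hs1 hs
      rw [hσ s hs]
      have hYs : Measurable (Y s) := hYm.comp measurable_prodMk_left
      have hvs : Measurable (v s) := hv.measurable.comp measurable_prodMk_left
      refine integral_gluedLaw (g := fun u => fderiv ℝ φ u (v s u)) hYm hf.isLipschitzWeight
        ?_ ?_ ?_
      · exact isBoundedBilinearMap_apply.continuous.measurable.comp (hcont.measurable.prodMk hvs)
      · exact integrable_clm_apply (hcont.measurable.comp hYs).aestronglyMeasurable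
          (fun _ => hC _) hs1
      · exact integrable_clm_apply (hcont.comp (continuous_chordPoint s)).aestronglyMeasurable
          (fun _ => hC _) (hv.integrable hs)
    have hsub : Ioc 0 τ ⊆ Icc (0 : ℝ) 1 :=
      Ioc_subset_Icc_self.trans (Icc_subset_Icc_right hτ.2)
    rw [intervalIntegral.integral_of_le hτ.1,
      integral_congr_ae (ae_restrict_of_ae_restrict_of_subset hsub hint),
      integral_add (hi1.mono_set hsub) (hi2.mono_set hsub), ← intervalIntegral.integral_of_le hτ.1,
      ← intervalIntegral.integral_of_le hτ.1, ← he1 τ hτ, ← he2 τ hτ, hσ τ hτ, hval τ, hinit]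
    ring

theorem exists_isContinuitySolution_gluedLaw (hfst : γ.map Prod.fst = μ₀)
    (hv : IsBarycentricVelocity γ v)
    (hYm : Measurable (Function.uncurry Y)) (hYc : ∀ u, Continuous fun s => Y s u)
    (hY : IsFlow μ₀ v Y) (hA : MeasurableSet A) {M : ℝ≥0∞} (hM : M ≠ ⊤)
    (hAM : ∀ u ∈ A, ∫⁻ s in Icc (0 : ℝ) 1, ‖v s (Y s u)‖ₑ ≤ M) (hf : IsWeightSolution γ v Aᶜ f) :
    ∃ σ : ℝ → ProbabilityMeasure (EuclideanSpace ℝ (Fin d)), IsContinuitySolution μ₀ v σ ∧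
      ∀ τ ∈ Icc (0 : ℝ) 1,
        (σ τ : Measure (EuclideanSpace ℝ (Fin d))) = gluedLaw μ₀ γ A Y f τ := by
  -- Time is clamped because the total mass is controlled on `[0, 1]` only.
  let σ : ℝ → ProbabilityMeasure (EuclideanSpace ℝ (Fin d)) := fun τ =>
    ⟨gluedLaw μ₀ γ A Y f (projIcc 0 1 zero_le_one τ),
      isProbabilityMeasure_gluedLaw hfst hYm hY hA hf (projIcc 0 1 zero_le_one τ).2⟩
  have hσ : ∀ τ ∈ Icc (0 : ℝ) 1,
      (σ τ : Measure (EuclideanSpace ℝ (Fin d))) = gluedLaw μ₀ γ A Y f τ := fun τ hτ => by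
    simp only [σ, projIcc_of_mem zero_le_one hτ, ProbabilityMeasure.coe_mk]
  exact ⟨σ, isContinuitySolution_gluedLaw hfst hv hYm hYc hY hA hM hAM hf hσ, hσ⟩

/-- Uniqueness equates the glued curve for `A` with the one for `∅`, which is the interpolant;
dropping the nonnegative weighted part leaves the inequality. -/
theorem restrict_map_le_interpolantLaw (hfst : γ.map Prod.fst = μ₀)
    (hint : Integrable chordDirection γ) (hv : IsBarycentricVelocity γ v)
    (huniq : ContinuityUniqueness μ₀ v)
    (hYm : Measurable (Function.uncurry Y)) (hYc : ∀ u, Continuous fun s => Y s u)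
    (hY : IsFlow μ₀ v Y) (hA : MeasurableSet A) {M : ℝ≥0∞} (hM : M ≠ ⊤)
    (hAM : ∀ u ∈ A, ∫⁻ s in Icc (0 : ℝ) 1, ‖v s (Y s u)‖ₑ ≤ M) {τ : ℝ}
    (hτ : τ ∈ Icc (0 : ℝ) 1) : (μ₀.restrict A).map (Y τ) ≤ interpolantLaw γ τ := by
  obtain ⟨f, hf⟩ := exists_weight_solution hA.compl hint hv
  obtain ⟨g, hg⟩ := exists_weight_solution (B := ∅ᶜ) MeasurableSet.empty.compl hint hv
  obtain ⟨σ, hσ, hσf⟩ := exists_isContinuitySolution_gluedLaw hfst hv hYm hYc hY hA hM hAM hf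
  obtain ⟨ρ, hρ, hρg⟩ := exists_isContinuitySolution_gluedLaw (M := 0) hfst hv hYm hYc hY
    MeasurableSet.empty ENNReal.zero_ne_top (by simp) hg
  have h := congrArg (fun m : ProbabilityMeasure _ => (m : Measure (EuclideanSpace ℝ (Fin d))))
    (huniq σ ρ hσ hρ τ hτ)
  simp only [hσf τ hτ, hρg τ hτ, gluedLaw_empty hg hτ] at h
  rw [← h]
  exact Measure.le_add_right le_rfl

theorem map_flow_eq_interpolantLaw (hfst : γ.map Prod.fst = μ₀)
    (hint : Integrable chordDirection γ) (hv : IsBarycentricVelocity γ v)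
    (huniq : ContinuityUniqueness μ₀ v)
    (hYm : Measurable (Function.uncurry Y)) (hYc : ∀ u, Continuous fun s => Y s u)
    (hY : IsFlow μ₀ v Y) {τ : ℝ} (hτ : τ ∈ Icc (0 : ℝ) 1) :
    μ₀.map (Y τ) = interpolantLaw γ τ := by
  have hYτ : Measurable (Y τ) := hYm.comp measurable_prodMk_left
  let G : EuclideanSpace ℝ (Fin d) → ℝ≥0∞ := fun u => ∫⁻ s in Icc (0 : ℝ) 1, ‖v s (Y s u)‖ₑ
  have hG : Measurable G := by
    have : Measurable fun z : EuclideanSpace ℝ (Fin d) × ℝ => ‖v z.2 (Y z.2 z.1)‖ₑ :=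
      (hv.measurable.comp (measurable_snd.prodMk (hYm.comp measurable_swap))).enorm
    exact this.lintegral_prod_right
  -- Along almost every curve the velocity has a finite integral, so these sets exhaust almost every
  -- initial point.
  let A : ℕ → Set (EuclideanSpace ℝ (Fin d)) := fun n => {u | G u ≤ n}
  have hA : ∀ n, MeasurableSet (A n) := fun n => measurableSet_le hG measurable_const
  have hAmono : Monotone A := fun m n hmn u (hu : G u ≤ m) =>
    show G u ≤ n from hu.trans (by exact_mod_cast hmn)
  have hAall : ∀ᵐ u ∂μ₀, u ∈ ⋃ n, A n := by
    filter_upwards [hY.integralCurve] with u hu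
    have h1 := (intervalIntegrable_iff_integrableOn_Icc_of_le zero_le_one).1 hu.1
    obtain ⟨n, hn⟩ := ENNReal.exists_nat_gt (hasFiniteIntegral_iff_enorm.1 h1.2).ne
    exact mem_iUnion.2 ⟨n, hn.le⟩
  have := Measure.isProbabilityMeasure_map (μ := μ₀) hYτ.aemeasurable
  have : IsProbabilityMeasure (interpolantLaw γ τ) :=
    Measure.isProbabilityMeasure_map (measurable_chordPoint τ).aemeasurable
  -- An inequality between two probability measures is an equality, so the upper bound suffices.
  refine Measure.eq_of_le_of_isProbabilityMeasure (Measure.le_iff.2 fun Q hQ => ?_)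
  have hlim := tendsto_measure_iUnion_atTop (μ := μ₀) (s := fun n => Y τ ⁻¹' Q ∩ A n)
    (fun m n hmn => inter_subset_inter_right _ (hAmono hmn))
  have hfull : μ₀ (⋃ n, Y τ ⁻¹' Q ∩ A n) = μ₀.map (Y τ) Q := by
    rw [Measure.map_apply hYτ hQ, ← inter_iUnion]
    refine measure_congr ?_
    filter_upwards [hAall] with u hu
    exact propext ⟨fun h => h.1, fun h => ⟨h, hu⟩⟩
  rw [hfull] at hlim
  refine le_of_tendsto hlim (Filter.Eventually.of_forall fun n => ?_)
  have h := restrict_map_le_interpolantLaw hfst hint hv huniq hYm hYc hY (hA n)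
    (ENNReal.natCast_ne_top n) (fun u hu => hu) hτ Q
  rwa [Measure.map_apply hYτ hQ, Measure.restrict_apply (hYτ hQ)] at h

end Transport

end RectifiedFlow

theorem mainTheorem1 {d : ℕ}
    (μ₀ μ₁ : Measure (EuclideanSpace ℝ (Fin d)))
    [IsProbabilityMeasure μ₀] [IsProbabilityMeasure μ₁]
    (γ : Measure (EuclideanSpace ℝ (Fin d) × EuclideanSpace ℝ (Fin d)))
    [IsProbabilityMeasure γ]
    (hγ : RectifiedFlow.IsCoupling γ μ₀ μ₁)
    (hint : Integrable RectifiedFlow.chordDirection γ)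
    (v X : ℝ → EuclideanSpace ℝ (Fin d) → EuclideanSpace ℝ (Fin d))
    (hv : RectifiedFlow.IsBarycentricVelocity γ v)
    (hX : RectifiedFlow.IsFlow μ₀ v X)
    (huniq : RectifiedFlow.ContinuityUniqueness μ₀ v) :
    (∀ τ ∈ Icc (0 : ℝ) 1, μ₀.map (X τ) = RectifiedFlow.interpolantLaw γ τ) ∧
      μ₀.map (X 1) = μ₁ := by
  obtain ⟨Y, hYm, hYc, hYX, hY⟩ := hX.exists_measurable_version
  have key : ∀ τ ∈ Icc (0 : ℝ) 1, μ₀.map (X τ) = RectifiedFlow.interpolantLaw γ τ := by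
    intro τ hτ
    rw [← RectifiedFlow.map_flow_eq_interpolantLaw hγ.1 hint hv huniq hYm hYc hY hτ]
    refine Measure.map_congr ?_
    filter_upwards [hYX] with u hu
    exact (hu τ hτ).symm
  refine ⟨key, ?_⟩
  have h1 : RectifiedFlow.chordPoint (d := d) 1 = Prod.snd := by
    ext1 p
    simp [RectifiedFlow.chordPoint]
  rw [key 1 (by simp), RectifiedFlow.interpolantLaw, h1, hγ.2]
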